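/- Let $\mathcal G$ be a connected metric graph with finitely many edges: each bounded edge $e$ is identified with $I_e=[0,\ell_e]$, $0<\ell_e<\infty$, and each unbounded edge with $I_e=[0,+\infty)$. Let $\mathcal K$ be its compact core, i.e. the union of its bounded edges, and assume that $\mathcal K$ is nonempty (if $\mathcal G$ is compact, $\mathcal K=\mathcal G$). Let $A\in L^2_{\rm loc}(\mathcal G,\mathbb R)$ and $V\in L^1_{\rm loc}(\mathcal G,\mathbb R)$ with $V\ge 1$, where "loc" means on every bounded subset, put $D_A:=\frac1i\frac{d}{dx}-A(x)$, and let $$H^1_A(\mathcal G,\mathbb C):=\Big\{u\in C(\mathcal G,\mathbb C): D_Au\in L^2(\mathcal G,\mathbb C),\ \int_{\mathcal G}V|u|^2\,dx<\infty\Big\},\qquad \|u\|^2:=\int_{\mathcal G}|D_Au|^2+V|u|^2\,dx .$$ Let $p>2$ and $$E(u):=\frac12\|u\|^2-\frac1p\int_{\mathcal K}|u|^p\,dx,\quad u\in H^1_A(\mathcal G,\mathbb C),\qquad H_\mu:=\Big\{u\in H^1_A(\mathcal G,\mathbb C):\int_{\mathcal G}|u|^2\,dx=\mu\Big\}.$$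 We say that $u$ is a critical point of $E$ constrained on $H_\mu$ with Lagrange multiplier $\lambda\in\mathbb R$ if $u\in H_\mu$ and $\langle E'(u),v\rangle=\lambda\,\operatorname{Re}\int_{\mathcal G}u\bar v\,dx$ for all $v\in H^1_A(\mathcal G,\mathbb C)$. Let $\lambda_1:=\inf_{u\in H^1_A(\mathcal G,\mathbb C)\setminus\{0\}}\|u\|^2/\|u\|_{L^2}^2$, and let $D_A^2+V$ denote the self-adjoint operator in $L^2(\mathcal G,\mathbb C)$ associated with the quadratic form $\int_{\mathcal G}(D_Au\,\overline{D_Av}+Vu\bar v)\,dx$ on $H^1_A(\mathcal G,\mathbb C)$. Consider the conditions: (G) the infimum $\lambda_1$ is achieved by some $\varphi_1$ with $\varphi_1|_{\mathcal K}\not\equiv0$; (G$_m$) for some $1\le m\le+\infty$, $D_A^2+V$ has an increasing sequence of $m$ distinct eigenvalues strictly below $\inf\sigma_{\rm ess}(D_A^2+V)$ (which is $+\infty$ if $\sigma_{\rm ess}(D_A^2+V)=\emptyset$). Theorem. Assume that (G) or (G$_m$) holds. Then, for every $\mu>0$, at least one of the following two alternatives occurs: (i) $E$ has a critical point constrained on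 $H_\mu$ with Lagrange multiplier $\lambda\in(-\infty,\lambda_1]$ (and $\lambda\in(-\infty,\lambda_1)$ if (G) holds); (ii) for every $\lambda\in(-\infty,\lambda_1)$ there is $\nu$ with $0<\nu<\mu$ such that $E$ has a critical point constrained on $H_\nu$ with Lagrange multiplier $\lambda$. -/

import Mathlib

open MeasureTheory

noncomputable section

/-- A connected metric graph. `Vert`, `Bdd`, `Half` are the types of vertices, of bounded edges and
of unbounded edges. A bounded edge `b` is identified with `[0, len b]`, its endpoints `0` and `len b`
being the vertices `init b` and `term b` (loops and multiple edges are allowed); an unbounded edge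
`h` is identified with `[0, +∞)`, its endpoint `0` being the vertex `root h`. -/
structure MetricGraph (Vert Bdd Half : Type*) where
  len : Bdd → ℝ
  len_pos : ∀ b, 0 < len b
  init : Bdd → Vert
  term : Bdd → Vert
  root : Half → Vert
  connected : (SimpleGraph.fromRel fun v w => ∃ b, init b = v ∧ term b = w).Connected

namespace MetricGraph

variable {Vert Bdd Half : Type*} (G : MetricGraph Vert Bdd Half)

/-- Pairs (edge, coordinate on the edge). A function on the graph is a function on this type;
only its values at `⟨e, x⟩` with `x ∈ G.interval e` matter. -/
abbrev Pt (_ : MetricGraph Vert Bdd Half) : Type _ := (_ : Bdd ⊕ Half) × ℝ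

/-- The interval `I_e` with which the edge `e` is identified. -/
def interval : Bdd ⊕ Half → Set ℝ
  | Sum.inl b => Set.Icc 0 (G.len b)
  | Sum.inr _ => Set.Ici 0

/-- `G.IsAt v q`: the point `q` is an endpoint of its edge, glued to the vertex `v`. -/
def IsAt (v : Vert) : G.Pt → Prop
  | ⟨Sum.inl b, x⟩ => (x = 0 ∧ G.init b = v) ∨ (x = G.len b ∧ G.term b = v)
  | ⟨Sum.inr h, x⟩ => x = 0 ∧ G.root h = v

/-- The measure `dx` on the graph: Lebesgue measure on each `I_e`. -/
def vol : Measure G.Pt :=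
  Measure.sum fun e => (volume.restrict (G.interval e)).map fun x => ⟨e, x⟩

/-- The compact core, consisting of all bounded edges. It is the whole graph if there are no
unbounded edges, that is, if the graph (with finitely many edges) is compact. -/
def core : Set G.Pt := {q | ∃ b, q.1 = Sum.inl b}

/-- `f` is continuous on the graph: on every edge, with values which agree at the vertices. -/
def IsCont (f : G.Pt → ℂ) : Prop :=
  (∀ e, ContinuousOn (fun x => f ⟨e, x⟩) (G.interval e)) ∧
    ∀ v q q', G.IsAt v q → G.IsAt v q' → f q = f q'

/-- On every edge `f` is locally absolutely continuous with (weak) derivative `g ∈ L¹_loc`. -/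
def HasWeakDeriv (f g : G.Pt → ℂ) : Prop :=
  ∀ e, ∀ x ∈ G.interval e, IntervalIntegrable (fun t => g ⟨e, t⟩) volume 0 x ∧
    f ⟨e, x⟩ = f ⟨e, 0⟩ + ∫ t in (0 : ℝ)..x, g ⟨e, t⟩

/-- `D_A f = g`, where `D_A = (1 / i) d/dx - A`; that is, `f' = i (g + A f)` weakly. -/
def IsMagDeriv (A : G.Pt → ℝ) (f g : G.Pt → ℂ) : Prop :=
  G.HasWeakDeriv f fun q => Complex.I * (g q + A q * f q)

/-- An almost everywhere property on the graph holds almost everywhere on every edge. -/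
theorem ae_edge {P : G.Pt → Prop} (h : ∀ᵐ q ∂G.vol, P q) (e : Bdd ⊕ Half) :
    ∀ᵐ x ∂(volume.restrict (G.interval e)), P ⟨e, x⟩ := by
  have hm : Measurable (fun x : ℝ => (⟨e, x⟩ : G.Pt)) :=
    fun s hs => MeasurableSpace.measurableSet_iInf.1 hs e
  exact ae_of_ae_map hm.aemeasurable (ae_mono (Measure.le_sum _ e) h)

theorem uIoc_subset_interval {e : Bdd ⊕ Half} {x : ℝ} (hx : x ∈ G.interval e) :
    Set.uIoc 0 x ⊆ G.interval e := by
  intro t ht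
  rcases e with b | h
  · rw [Set.uIoc_of_le hx.1] at ht
    exact ⟨ht.1.le, ht.2.trans hx.2⟩
  · rw [Set.uIoc_of_le hx] at ht
    exact ht.1.le

theorem HasWeakDeriv.congr {f g g' : G.Pt → ℂ} (h : G.HasWeakDeriv f g) (hg : g =ᵐ[G.vol] g') :
    G.HasWeakDeriv f g' := by
  intro e x hx
  have hae : ∀ᵐ t ∂(volume.restrict (Set.uIoc 0 x)), g ⟨e, t⟩ = g' ⟨e, t⟩ :=
    ae_restrict_of_ae_restrict_of_subset (G.uIoc_subset_interval hx) (G.ae_edge hg e)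
  refine ⟨(h e x hx).1.congr_ae hae, ?_⟩
  rw [(h e x hx).2, intervalIntegral.integral_congr_ae_restrict hae]

theorem HasWeakDeriv.add {f g f' g' : G.Pt → ℂ} (h : G.HasWeakDeriv f g)
    (h' : G.HasWeakDeriv f' g') : G.HasWeakDeriv (f + f') (g + g') := by
  intro e x hx
  refine ⟨(h e x hx).1.add (h' e x hx).1, ?_⟩
  simp only [Pi.add_apply]
  rw [intervalIntegral.integral_add (h e x hx).1 (h' e x hx).1, (h e x hx).2, (h' e x hx).2]
  ring

theorem HasWeakDeriv.smul {f g : G.Pt → ℂ} (c : ℂ) (h : G.HasWeakDeriv f g) :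
    G.HasWeakDeriv (c • f) (c • g) := by
  intro e x hx
  refine ⟨(h e x hx).1.const_mul c, ?_⟩
  simp only [Pi.smul_apply, smul_eq_mul]
  rw [intervalIntegral.integral_const_mul, (h e x hx).2]
  ring

/-- `L²(G, ℂ)`. -/
abbrev L2 : Type _ := Lp ℂ 2 G.vol

/-- The weighted measure `V dx`. -/
def volV (V : G.Pt → ℝ) : Measure G.Pt :=
  G.vol.withDensity fun q => ENNReal.ofReal (V q)

/-- The Hilbert sum `L²(V dx) ⊕ L²(dx)`, with `‖(u, w)‖² = ∫ V |u|² dx + ∫ |w|² dx`. -/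
abbrev Pairs (V : G.Pt → ℝ) : Type _ := WithLp 2 (Lp ℂ 2 (G.volV V) × G.L2)

variable (A V : G.Pt → ℝ)

/-- The magnetic Sobolev space `H¹_A(G, ℂ)`, realised as the space of the pairs `(u, D_A u)` with
`u ∈ C(G, ℂ)`, `D_A u ∈ L²` and `∫ V |u|² < ∞`. Its norm and inner product, inherited from
`Pairs`, are `‖u‖² = ∫ |D_A u|² + V |u|²` and the corresponding inner product. -/
def H1A : Submodule ℂ (G.Pairs V) where
  carrier := {U | ∃ f : G.Pt → ℂ, G.IsCont f ∧ U.fst =ᵐ[G.volV V] f ∧ G.IsMagDeriv A f U.snd}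
  zero_mem' := by
    refine ⟨0, ⟨fun e => continuousOn_const, fun _ _ _ _ _ => rfl⟩, Lp.coeFn_zero _ _ _, ?_⟩
    have h0 : G.HasWeakDeriv 0 0 := fun e x _ => ⟨intervalIntegrable_const, by simp⟩
    refine h0.congr G ?_
    filter_upwards [Lp.coeFn_zero ℂ 2 G.vol] with q hq
    change (0 : ℂ) = Complex.I * ((0 : G.L2) q + A q * 0)
    rw [show (0 : G.L2) q = 0 from hq]
    simp
  add_mem' := by
    rintro U U' ⟨f, hf, hU, hd⟩ ⟨f', hf', hU', hd'⟩
    refine ⟨f + f', ⟨fun e => (hf.1 e).add (hf'.1 e), fun v q q' h h' => ?_⟩,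
      (Lp.coeFn_add _ _).trans (hU.add hU'), (hd.add G hd').congr G ?_⟩
    · simp only [Pi.add_apply, hf.2 v q q' h h', hf'.2 v q q' h h']
    · filter_upwards [Lp.coeFn_add U.snd U'.snd] with q hq
      simp only [WithLp.add_snd, hq, Pi.add_apply]
      ring
  smul_mem' := by
    rintro c U ⟨f, hf, hU, hd⟩
    refine ⟨c • f, ⟨fun e => (hf.1 e).const_smul c, fun v q q' h h' => ?_⟩,
      (Lp.coeFn_smul _ _).trans (hU.const_smul c), (hd.smul G c).congr G ?_⟩
    · simp only [Pi.smul_apply, hf.2 v q q' h h']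
    · filter_upwards [Lp.coeFn_smul c U.snd] with q hq
      simp only [WithLp.smul_snd, hq, Pi.smul_apply, smul_eq_mul]
      ring

variable {G A V}

/-- The function `u` underlying an element of `H¹_A(G, ℂ)`. -/
def fn (u : G.H1A A V) : G.Pt → ℂ := (u : G.Pairs V).fst

/-- The function `D_A u`. -/
def magD (u : G.H1A A V) : G.Pt → ℂ := (u : G.Pairs V).snd

/-- The mass `‖u‖₂² = ∫ |u|² dx`. -/
def mass (u : G.H1A A V) : ℝ := ∫ q, ‖fn u q‖ ^ 2 ∂G.vol

/-- `Ψ(u) = (1 / p) ∫ |u|^p dx` over the compact core (over the whole graph if it is compact). -/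
def Psi (p : ℝ) (u : G.H1A A V) : ℝ := 1 / p * ∫ q in G.core, ‖fn u q‖ ^ p ∂G.vol

/-- The energy `E(u) = ‖u‖² / 2 - Ψ(u)`. -/
def energy (p : ℝ) (u : G.H1A A V) : ℝ := 1 / 2 * ‖u‖ ^ 2 - Psi p u

/-- The sphere `H_μ` of functions of mass `μ`. -/
def massSphere (G : MetricGraph Vert Bdd Half) (A V : G.Pt → ℝ) (μ : ℝ) : Set (G.H1A A V) :=
  {u | mass u = μ}

/-- `u` is a critical point of `E` constrained on `H_μ` with Lagrange multiplier `l`: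
`u ∈ H_μ` and the (real) Fréchet derivative of `E` at `u` is `v ↦ l (u, v)₂`, where
`(u, v)₂ = Re ∫ u v̄ dx`. -/
def IsCritical (p μ l : ℝ) (u : G.H1A A V) : Prop :=
  u ∈ G.massSphere A V μ ∧
    ∃ E' : G.H1A A V →L[ℝ] ℝ, HasFDerivAt (energy p) E' u ∧
      ∀ v, E' v = l * (∫ q, fn u q * starRingEnd ℂ (fn v q) ∂G.vol).re

variable (G A V)

/-- `λ₁`, the infimum of the Rayleigh quotient `‖u‖² / ‖u‖₂²` over `H¹_A ∖ {0}`. -/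
def lambda1 : ℝ := ⨅ u : {u : G.H1A A V // u ≠ 0}, ‖u.1‖ ^ 2 / mass u.1

/-- Condition (G): `λ₁` is achieved by some `φ` that does not vanish identically on the core. -/
def CondG : Prop :=
  ∃ φ : G.H1A A V, φ ≠ 0 ∧ ‖φ‖ ^ 2 / mass φ = G.lambda1 A V ∧
    ¬ fn φ =ᵐ[G.vol.restrict G.core] 0

/-- The graph `{(u, T u) | u ∈ dom T}` of the self-adjoint operator `T = D_A² + V` in `L²`
associated with the quadratic form of `H¹_A`: `u ∈ dom T` and `T u = f` if and only if
`u ∈ H¹_A`, `f ∈ L²` and `(u, v) = ∫ f v̄ dx` for every `v ∈ H¹_A`. -/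
def opGraph : Set (G.L2 × G.L2) :=
  {y | ∃ u : G.H1A A V, y.1 =ᵐ[G.vol] fn u ∧
    ∀ v : G.H1A A V, inner ℂ v u = ∫ q, y.2 q * starRingEnd ℂ (fn v q) ∂G.vol}

end MetricGraph

/-! Spectral notions for a linear operator `T` in a Hilbert space, given by its graph `Γ`. -/

namespace OpGraph

variable {X : Type*} [NormedAddCommGroup X] [NormedSpace ℂ X] (Γ : Set (X × X))

/-- `z` such that `T - z : dom T → X` is onto and one-to-one, with bounded inverse. -/
def resolvent : Set ℂ :=
  {z | (∀ g, ∃ y ∈ Γ, y.2 - z • y.1 = g) ∧ ∃ C : ℝ, ∀ y ∈ Γ, ‖y.1‖ ≤ C * ‖y.2 - z • y.1‖}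

def spectrum : Set ℂ := (resolvent Γ)ᶜ

/-- The eigenspace `ker (T - z)` (the span of a linear subspace). -/
def eigenspace (z : ℂ) : Submodule ℂ X := Submodule.span ℂ {x | (x, z • x) ∈ Γ}

def IsEigenvalue (z : ℂ) : Prop := ∃ x, x ≠ 0 ∧ (x, z • x) ∈ Γ

/-- The isolated points of the spectrum which are eigenvalues of finite multiplicity. -/
def discreteSpectrum : Set ℂ :=
  {z | z ∈ spectrum Γ ∧ (∃ ε > 0, ∀ w ∈ spectrum Γ, dist w z < ε → w = z) ∧
    IsEigenvalue Γ z ∧ FiniteDimensional ℂ (eigenspace Γ z)}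

def essSpectrum : Set ℂ := spectrum Γ \ discreteSpectrum Γ

/-- `inf σ_ess(T)` for a self-adjoint (so with real spectrum) `T`; it is `+∞` if `σ_ess(T) = ∅`. -/
def infEss : EReal := ⨅ t ∈ {t : ℝ | (t : ℂ) ∈ essSpectrum Γ}, (t : EReal)

end OpGraph

namespace MetricGraph

variable {Vert Bdd Half : Type*} (G : MetricGraph Vert Bdd Half) (A V : G.Pt → ℝ)

/-- Condition (G_m), `1 ≤ m ≤ ∞`: there is an increasing sequence of `m` eigenvalues of `D_A² + V`
below the infimum of its essential spectrum (the sequence is `l 0 < l 1 < ...`). -/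
def CondGm (m : ℕ∞) : Prop :=
  1 ≤ m ∧ ∃ l : ℕ → ℝ, (∀ i j : ℕ, i < j → (j : ℕ∞) < m → l i < l j) ∧
    ∀ j : ℕ, (j : ℕ∞) < m → OpGraph.IsEigenvalue (G.opGraph A V) (l j : ℂ) ∧
      (l j : EReal) < OpGraph.infEss (G.opGraph A V)

end MetricGraph

end

/-! Write `Λ` for `λ₁` and `m` for the mass, and suppose first that (G) holds, with optimizer `φ`.
Fix `l < Λ` and look for critical points of the penalized action `‖u‖² / 2 - (l / 2) m u - Ψ u - κ
(m u - μ)⁺`, where `l + 2κ = Λ - η` with a small `η > 0`. Its critical points have frequency `l`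
where the mass is below `μ` and `Λ - η` where it is above; at mass exactly `μ` any frequency in
between may occur. The first case gives alternative (ii) for this `l`, the last gives alternative
(i). So it suffices to find a nonzero critical point whose mass does not exceed `μ`.

At a critical point with `m w > μ` the Euler identity `⟪Ψ' w, w⟫ = p Ψ w` makes the action equal to
`κμ + (p/2 - 1) Ψ w`, hence at least `κμ`. The mountain pass level, however, is strictly below `κμ`:
along the ray through `φ` the quadratic part at frequency `Λ - η` is only `η t² / 2`, and since `Ψ φ
> 0`, which is what (G) provides, the nonlinear term beats it for `t² ≥ μ/2` once `η` is small
(`MassProblem.act_ray_le`). This excludes `m w > μ`.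

Critical points are produced with the positive part smoothed at scale `ε`, and `ε` then tends to
`0`. Since `Ψ` and the penalty are convex and enter with a minus sign, an explicit gradient step of
fixed length decreases the action, and iterating it on a segment replaces a deformation lemma
(`exists_small_gradient_of_descent`). Almost critical sequences are bounded because `p > 2`, and
they converge because `Ψ` sees only the compact core, where `H¹_A` embeds compactly in the
continuous functions, while the linear part stays coercive at frequencies up to `Λ - η`
(`MassProblem.exists_tendsto_of_almost_critical`). Together this is `MassProblem.exists_solution`.

If (G) fails, (G_m) places `Λ` below the essential spectrum. As `Λ` lies in the spectrum
(`lambda1_mem_spectrum`), it is an eigenvalue, and its eigenfunction must vanish on the core. The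
nonlinearity does not see it, so its multiple of mass `μ` is critical with multiplier `Λ`. -/

noncomputable section

open MeasureTheory Filter Topology
open scoped RealInnerProductSpace

/-! ### Smoothed positive part -/

/-- The derivative of the smoothed positive part `softPos`: a ramp from `0` to `1` on `[0, ε]`. -/
def ramp (ε x : ℝ) : ℝ := max 0 (min 1 (x / ε))

/-- A convex `C¹` approximation from below of the positive part `max x 0`. -/
def softPos (ε x : ℝ) : ℝ := ramp ε x * x - ε / 2 * ramp ε x ^ 2

theorem ramp_nonneg (ε x : ℝ) : 0 ≤ ramp ε x := le_max_left _ _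

theorem ramp_le_one (ε x : ℝ) : ramp ε x ≤ 1 := max_le zero_le_one (min_le_left _ _)

theorem ramp_of_nonpos {ε x : ℝ} (hε : 0 < ε) (hx : x ≤ 0) : ramp ε x = 0 :=
  max_eq_left ((min_le_right _ _).trans (div_nonpos_of_nonpos_of_nonneg hx hε.le))

theorem ramp_of_ge {ε x : ℝ} (hε : 0 < ε) (hx : ε ≤ x) : ramp ε x = 1 := by
  have : 1 ≤ x / ε := (one_le_div hε).2 hx
  rw [ramp, min_eq_left this, max_eq_right zero_le_one]

theorem continuous_ramp (ε : ℝ) : Continuous (ramp ε) := by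
  unfold ramp; fun_prop

theorem continuous_softPos (ε : ℝ) : Continuous (softPos ε) := by
  have := continuous_ramp ε
  unfold softPos; fun_prop

/-- `softPos ε` is the maximum over `σ ∈ [0, 1]` of the affine functions `σ x - ε σ² / 2`, attained
at `σ = ramp ε x`. Nonnegativity, the asymptote `x - ε / 2` and the subgradient inequality are all
instances. -/
theorem le_softPos {ε x σ : ℝ} (hε : 0 < ε) (h0 : 0 ≤ σ) (h1 : σ ≤ 1) :
    σ * x - ε / 2 * σ ^ 2 ≤ softPos ε x := by
  unfold softPos
  rcases le_total x 0 with hx | hx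
  · rw [ramp_of_nonpos hε hx]
    nlinarith [mul_nonneg h0 (neg_nonneg.2 hx), mul_nonneg hε.le (sq_nonneg σ)]
  rcases le_total ε x with hx' | hx'
  · rw [ramp_of_ge hε hx']
    nlinarith [mul_nonneg (sub_nonneg.2 h1) (sub_nonneg.2 hx'),
      mul_nonneg hε.le (sq_nonneg (1 - σ))]
  · have : ramp ε x = x / ε := by
      rw [ramp, min_eq_right ((div_le_one hε).2 hx'), max_eq_right (by positivity)]
    rw [this]
    obtain ⟨s, rfl⟩ : ∃ s, x = ε * s := ⟨x / ε, by field_simp⟩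
    rw [mul_div_cancel_left₀ _ hε.ne']
    nlinarith [mul_nonneg hε.le (sq_nonneg (s - σ))]

theorem softPos_nonneg {ε : ℝ} (hε : 0 < ε) (x : ℝ) : 0 ≤ softPos ε x := by
  simpa using le_softPos (x := x) hε le_rfl zero_le_one

theorem sub_le_softPos {ε : ℝ} (hε : 0 < ε) (x : ℝ) : x - ε / 2 ≤ softPos ε x := by
  simpa using le_softPos (x := x) hε zero_le_one le_rfl

theorem softPos_le_ramp_mul {ε : ℝ} (hε : 0 < ε) (x : ℝ) : softPos ε x ≤ ramp ε x * x := by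
  unfold softPos
  nlinarith [mul_nonneg hε.le (sq_nonneg (ramp ε x))]

theorem softPos_add_le {ε : ℝ} (hε : 0 < ε) (x y : ℝ) :
    softPos ε x + ramp ε x * (y - x) ≤ softPos ε y := by
  have := le_softPos (x := y) hε (ramp_nonneg ε x) (ramp_le_one ε x)
  have h : softPos ε x = ramp ε x * x - ε / 2 * ramp ε x ^ 2 := rfl
  linarith

/-! ### Mountain pass by iterated gradient steps -/

section Descent

variable {H : Type*} [NormedAddCommGroup H] [NormedSpace ℝ H]

/-- A mountain pass principle for functions which decrease along a continuous explicit gradient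
step: iterating the step on the segment `[0, e]` produces almost critical points. -/
theorem exists_small_gradient_of_descent {f : H → ℝ} {d : H → H} {e : H} {τ r h c : ℝ}
    (hτ : 0 < τ) (hf : Continuous f) (hd : Continuous d) (hd0 : d 0 = 0)
    (hdesc : ∀ u, ∀ s ∈ Set.Icc 0 τ, f (u - s • d u) ≤ f u - s / 2 * ‖d u‖ ^ 2)
    (hr : 0 < r) (hring : ∀ u, ‖u‖ = r → h ≤ f u) (he : r ≤ ‖e‖) (hfe : f e < h)
    (hc : ∀ t ∈ Set.Icc (0 : ℝ) 1, f (t • e) ≤ c) {δ : ℝ} (hδ : 0 < δ) :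
    ∃ u, h ≤ f u ∧ f u ≤ c ∧ ‖d u‖ ≤ δ := by
  set T : H → H := fun u => u - τ • d u with hT
  have hTc : Continuous T := by fun_prop
  have hTn : ∀ n, Continuous (T^[n]) := fun n => hTc.iterate n
  have hTdesc : ∀ u, f (T u) ≤ f u - τ / 2 * ‖d u‖ ^ 2 := fun u => hdesc u τ ⟨hτ.le, le_rfl⟩
  have hTle : ∀ u, f (T u) ≤ f u := fun u => (hTdesc u).trans (by
    have : 0 ≤ τ / 2 * ‖d u‖ ^ 2 := by positivity
    linarith)
  have hT0 : ∀ n, T^[n] 0 = 0 := fun n => Function.iterate_fixed (by simp [hT, hd0]) n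
  -- The iterates of `e` cannot enter the ball of radius `r`: a step moves along a segment on which
  -- `f` never exceeds its initial value, below `h`, whereas crossing the sphere would require a
  -- value at least `h`.
  have hend : ∀ n, r ≤ ‖T^[n] e‖ ∧ f (T^[n] e) < h := by
    intro n
    induction n with
    | zero => exact ⟨he, hfe⟩
    | succ n ih =>
      rw [Function.iterate_succ_apply']
      refine ⟨?_, (hTle _).trans_lt ih.2⟩
      by_contra! hlt
      set w := T^[n] e
      have hcont : ContinuousOn (fun s : ℝ => ‖w - s • d w‖) (Set.Icc 0 τ) := by fun_prop
      have hmem : r ∈ Set.Icc ‖w - τ • d w‖ ‖w - (0 : ℝ) • d w‖ := ⟨hlt.le, by simpa using ih.1⟩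
      obtain ⟨s, hs, hsr⟩ := intermediate_value_Icc' hτ.le hcont hmem
      have h1 := hring _ hsr
      have h2 := hdesc w s hs
      have h3 : 0 ≤ s / 2 * ‖d w‖ ^ 2 := by have := hs.1; positivity
      linarith [ih.2]
  -- The sets `K n` decrease because `f` decreases along the step. Each is nonempty because the path
  -- `t ↦ T^[n] (t • e)` joins the fixed point `0` to a point outside the ball, and so meets the
  -- sphere. A parameter common to all of them has its whole orbit at levels in `[h, c]`.
  set K : ℕ → Set ℝ := fun n => Set.Icc 0 1 ∩ {t | h ≤ f (T^[n] (t • e))} with hK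
  have hclosed : ∀ n, IsClosed {t : ℝ | h ≤ f (T^[n] (t • e))} := fun n =>
    isClosed_le continuous_const (hf.comp ((hTn n).comp (by fun_prop)))
  obtain ⟨t, ht⟩ : (⋂ n, K n).Nonempty := by
    refine IsCompact.nonempty_iInter_of_sequence_nonempty_isCompact_isClosed K ?_ ?_
      (isCompact_Icc.inter_right (hclosed 0)) fun n => isClosed_Icc.inter (hclosed n)
    · rintro n t ⟨h1, h2⟩
      refine ⟨h1, ?_⟩
      simp only [Set.mem_ofPred_eq, Function.iterate_succ_apply'] at h2 ⊢
      exact h2.trans (hTle _)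
    · intro n
      have hcont : ContinuousOn (fun s : ℝ => ‖T^[n] (s • e)‖) (Set.Icc 0 1) :=
        (((hTn n).comp (by fun_prop : Continuous fun s : ℝ => s • e)).norm).continuousOn
      have hmem : r ∈ Set.Icc ‖T^[n] ((0 : ℝ) • e)‖ ‖T^[n] ((1 : ℝ) • e)‖ := by
        rw [zero_smul, one_smul, hT0, norm_zero]
        exact ⟨hr.le, (hend n).1⟩
      obtain ⟨s, hs, hsr⟩ := intermediate_value_Icc zero_le_one hcont hmem
      exact ⟨s, hs, hring _ hsr⟩
  rw [Set.mem_iInter] at ht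
  have hlow : ∀ n, h ≤ f (T^[n] (t • e)) := fun n => (ht n).2
  have hup : ∀ n, f (T^[n] (t • e)) ≤ c := by
    intro n
    induction n with
    | zero => exact hc t (ht 0).1
    | succ n ih =>
      rw [Function.iterate_succ_apply']
      exact (hTle _).trans ih
  -- If the gradient stayed larger than `δ` along this orbit, each step would cost at least `τ δ² /
  -- 2`, and `f` would eventually fall below `h`.
  by_contra! hcon
  have hbig : ∀ n, δ < ‖d (T^[n] (t • e))‖ := fun n => hcon _ (hlow n) (hup n)
  have hdrop : ∀ n : ℕ, f (T^[n] (t • e)) ≤ c - n * (τ / 2 * δ ^ 2) := by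
    intro n
    induction n with
    | zero => simpa using hup 0
    | succ n ih =>
      rw [Function.iterate_succ_apply']
      have h1 := hTdesc (T^[n] (t • e))
      have h2 : τ / 2 * δ ^ 2 ≤ τ / 2 * ‖d (T^[n] (t • e))‖ ^ 2 := by
        have := (hbig n).le
        gcongr
      push_cast
      linarith
  obtain ⟨n, hn⟩ := exists_nat_gt ((c - h) / (τ / 2 * δ ^ 2))
  have hpos : 0 < τ / 2 * δ ^ 2 := by positivity
  rw [div_lt_iff₀ hpos] at hn
  linarith [hdrop n, hlow n]

end Descent

/-! ### Differentiability from subgradients -/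

section Convex

variable {H : Type*} [NormedAddCommGroup H] [InnerProductSpace ℝ H]

/-- A function with a continuous field of subgradients is differentiable. -/
theorem hasFDerivAt_of_subgradient {Ψ : H → ℝ} {g : H → H} (hg : Continuous g)
    (hsub : ∀ u v, Ψ u + ⟪g u, v - u⟫ ≤ Ψ v) (u : H) : HasFDerivAt Ψ (innerSL ℝ (g u)) u := by
  rw [hasFDerivAt_iff_isLittleO]
  rw [Asymptotics.isLittleO_iff]
  intro c hc
  have hev : ∀ᶠ v in 𝓝 u, ‖g v - g u‖ < c := by
    have := (hg.tendsto u)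
    rw [tendsto_iff_norm_sub_tendsto_zero] at this
    exact this.eventually_lt_const hc
  filter_upwards [hev] with v hv
  -- The subgradient inequalities at `u` and at `v` place the remainder between `0` and `⟪g v - g u,
  -- v - u⟫`.
  have h1 := hsub u v
  have h2 := hsub v u
  have h3 : ⟪g v, u - v⟫ = - ⟪g v, v - u⟫ := by rw [← inner_neg_right, neg_sub]
  have h4 : ⟪g v - g u, v - u⟫ ≤ ‖g v - g u‖ * ‖v - u‖ := real_inner_le_norm _ _
  rw [inner_sub_left] at h4
  have h5 : ‖g v - g u‖ * ‖v - u‖ ≤ c * ‖v - u‖ := by gcongr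
  rw [innerSL_apply_apply, Real.norm_of_nonneg (by linarith)]
  linarith

end Convex

/-! ### Abstract problem and penalized action -/

/-- A mass `⟪S u, u⟫` bounded by `‖u‖²`, and a convex `p`-homogeneous nonlinearity `Ψ` with
compact gradient `g`, on a real Hilbert space. -/
structure MassProblem (H : Type*) [NormedAddCommGroup H] [InnerProductSpace ℝ H] (p : ℝ) where
  S : H →L[ℝ] H
  symm : ∀ u v, ⟪S u, v⟫ = ⟪u, S v⟫
  pos : ∀ u, u ≠ 0 → 0 < ⟪S u, u⟫
  le_sq : ∀ u, ⟪S u, u⟫ ≤ ‖u‖ ^ 2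
  Ψ : H → ℝ
  g : H → H
  nonneg : ∀ u, 0 ≤ Ψ u
  cont : Continuous g
  compact : ∀ R : ℝ, ∃ K, IsCompact K ∧ ∀ u, ‖u‖ ≤ R → g u ∈ K
  sub : ∀ u v, Ψ u + ⟪g u, v - u⟫ ≤ Ψ v
  zero : g 0 = 0
  euler : ∀ u, ⟪g u, u⟫ = p * Ψ u
  hom : ∀ (t : ℝ) u, 0 ≤ t → Ψ (t • u) = t ^ p * Ψ u
  bound : ∃ C, 0 ≤ C ∧ ∀ u, Ψ u ≤ C * ‖u‖ ^ p

namespace MassProblem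

variable {H : Type*} [NormedAddCommGroup H] [InnerProductSpace ℝ H] {p : ℝ} (D : MassProblem H p)

/-- The mass. -/
def m (u : H) : ℝ := ⟪D.S u, u⟫

theorem m_nonneg (u : H) : 0 ≤ D.m u := by
  rcases eq_or_ne u 0 with rfl | h
  · simp [m]
  · exact (D.pos u h).le

theorem m_add (u v : H) : D.m (u + v) = D.m u + 2 * ⟪D.S u, v⟫ + D.m v := by
  have h : ⟪D.S v, u⟫ = ⟪D.S u, v⟫ := by rw [D.symm, real_inner_comm]
  simp only [m, map_add, inner_add_left, inner_add_right, h]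
  ring

theorem m_smul (t : ℝ) (u : H) : D.m (t • u) = t ^ 2 * D.m u := by
  simp only [m, map_smul, real_inner_smul_left, real_inner_smul_right]
  ring

theorem continuous_m : Continuous D.m := by
  unfold m; fun_prop

theorem hasFDerivAt (u : H) : HasFDerivAt D.Ψ (innerSL ℝ (D.g u)) u :=
  hasFDerivAt_of_subgradient D.cont D.sub u

theorem hasFDerivAt_energy (u : H) :
    HasFDerivAt (fun u => 1 / 2 * ‖u‖ ^ 2 - D.Ψ u) (innerSL ℝ (u - D.g u)) u := by
  have h2 : HasFDerivAt (fun u : H => ‖u‖ ^ 2) (2 • innerSL ℝ u) u :=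
    (hasStrictFDerivAt_norm_sq u).hasFDerivAt
  have h3 : innerSL ℝ (u - D.g u) = (1 / 2 : ℝ) • (2 • innerSL ℝ u) - innerSL ℝ (D.g u) := by
    rw [map_sub]
    congr 1
    ext v
    simp
  rw [h3]
  exact (h2.const_mul (1 / 2 : ℝ)).sub (D.hasFDerivAt u)

/-- Such a `u` minimizes the nonnegative function `Ψ`. -/
theorem g_eq_zero_of_Ψ_eq_zero {u : H} (h : D.Ψ u = 0) : D.g u = 0 := by
  have hmin : IsLocalMin D.Ψ u := Eventually.of_forall fun v => h.le.trans (D.nonneg v)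
  have h1 := hmin.hasFDerivAt_eq_zero (D.hasFDerivAt u)
  have h2 : ⟪D.g u, D.g u⟫ = 0 := by
    rw [← innerSL_apply_apply, h1]; rfl
  exact inner_self_eq_zero.1 h2

theorem inner_sub_g_of_solution {l : ℝ} {u : H} (h : u - l • D.S u - D.g u = 0) (v : H) :
    ⟪u - D.g u, v⟫ = l * ⟪D.S u, v⟫ := by
  have h1 : u - D.g u = l • D.S u := by
    rw [← sub_eq_zero, ← h]; abel
  rw [h1, real_inner_smul_left]

theorem sub_smul_eq_zero_of_inner {l : ℝ} {u : H} (h : ∀ v, ⟪u, v⟫ = l * ⟪D.S u, v⟫) :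
    u - l • D.S u = 0 :=
  ext_inner_right ℝ fun v => by
    rw [inner_zero_left, inner_sub_left, real_inner_smul_left, h v, sub_self]

theorem continuous_Ψ : Continuous D.Ψ :=
  continuous_iff_continuousAt.2 fun u => (D.hasFDerivAt u).continuousAt

/-- The action at frequency `l`, penalized above the mass `μ`, so that the frequency becomes
`l + 2 κ` there. -/
def act (l κ μ ε : ℝ) (u : H) : ℝ :=
  1 / 2 * ‖u‖ ^ 2 - l / 2 * D.m u - D.Ψ u - κ * softPos ε (D.m u - μ)

/-- The frequency which corresponds to the penalized action. -/
def freq (l κ μ ε : ℝ) (u : H) : ℝ := l + 2 * κ * ramp ε (D.m u - μ)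

/-- The gradient of the penalized action. -/
def dact (l κ μ ε : ℝ) (u : H) : H := u - D.freq l κ μ ε u • D.S u - D.g u

theorem continuous_act (l κ μ ε : ℝ) : Continuous (D.act l κ μ ε) := by
  have h1 := D.continuous_m
  have h2 := D.continuous_Ψ
  have h3 := continuous_softPos ε
  unfold act; fun_prop

theorem continuous_dact (l κ μ ε : ℝ) : Continuous (D.dact l κ μ ε) := by
  have h1 := D.continuous_m
  have h2 := D.cont
  have h3 := continuous_ramp ε
  unfold dact freq; fun_prop

/-- Both `-Ψ` and the penalty term are concave, the latter because `softPos ε` is convex and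
nondecreasing and the mass is convex. Only the quadratic part contributes to the second-order term,
so its constant does not involve `κ`, `ε` or any Lipschitz bound on `g`. -/
theorem act_add_le {l κ μ ε : ℝ} (hκ : 0 ≤ κ) (hε : 0 < ε) (u v : H) :
    D.act l κ μ ε (u + v) ≤
      D.act l κ μ ε u + ⟪D.dact l κ μ ε u, v⟫ + (1 + |l|) / 2 * ‖v‖ ^ 2 := by
  have h1 : ‖u + v‖ ^ 2 = ‖u‖ ^ 2 + 2 * ⟪u, v⟫ + ‖v‖ ^ 2 := norm_add_sq_real u v
  have h2 := D.m_add u v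
  have h3 := D.sub u (u + v)
  rw [add_sub_cancel_left] at h3
  have h4 := softPos_add_le hε (D.m u - μ) (D.m (u + v) - μ)
  have h5 : 0 ≤ ramp ε (D.m u - μ) * D.m v := mul_nonneg (ramp_nonneg _ _) (D.m_nonneg v)
  have h6 : -(l / 2 * D.m v) ≤ |l| / 2 * ‖v‖ ^ 2 := by
    have ha : -l ≤ |l| := neg_le_abs l
    have hb := D.m_nonneg v
    have hc := D.le_sq v
    calc -(l / 2 * D.m v) = -l * D.m v / 2 := by ring
      _ ≤ |l| * ‖v‖ ^ 2 / 2 := by gcongr; exact hc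
      _ = _ := by ring
  have h7 : ⟪D.dact l κ μ ε u, v⟫ =
      ⟪u, v⟫ - (l + 2 * κ * ramp ε (D.m u - μ)) * ⟪D.S u, v⟫ - ⟪D.g u, v⟫ := by
    simp only [dact, freq, inner_sub_left, real_inner_smul_left]
  have h8 : κ * (softPos ε (D.m u - μ) + ramp ε (D.m u - μ) * (2 * ⟪D.S u, v⟫)) ≤
      κ * softPos ε (D.m (u + v) - μ) := by
    gcongr
    refine le_trans ?_ h4
    rw [h2]
    nlinarith
  unfold act
  rw [h7, h1, h2]
  rw [h2] at h8
  linarith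

theorem act_step_le {l κ μ ε : ℝ} (hκ : 0 ≤ κ) (hε : 0 < ε) (u : H) {s : ℝ}
    (hs : s ∈ Set.Icc 0 (1 / (1 + |l|))) :
    D.act l κ μ ε (u - s • D.dact l κ μ ε u) ≤
      D.act l κ μ ε u - s / 2 * ‖D.dact l κ μ ε u‖ ^ 2 := by
  have h := D.act_add_le (l := l) (μ := μ) hκ hε u (-(s • D.dact l κ μ ε u))
  rw [← sub_eq_add_neg, inner_neg_right, real_inner_smul_right, real_inner_self_eq_norm_sq,
    norm_neg, norm_smul, Real.norm_of_nonneg hs.1] at h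
  have h1 : (1 + |l|) * s ≤ 1 := by
    have := hs.2
    rwa [le_div_iff₀ (by positivity), mul_comm] at this
  have h2 : (1 + |l|) / 2 * (s * ‖D.dact l κ μ ε u‖) ^ 2 ≤ s / 2 * ‖D.dact l κ μ ε u‖ ^ 2 := by
    calc _ = ((1 + |l|) * s) * (s / 2 * ‖D.dact l κ μ ε u‖ ^ 2) := by ring
      _ ≤ 1 * (s / 2 * ‖D.dact l κ μ ε u‖ ^ 2) := by
        have := hs.1
        gcongr
      _ = _ := one_mul _
  linarith

theorem act_le {l κ μ ε : ℝ} (hκ : 0 ≤ κ) (hε : 0 < ε) (u : H) :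
    D.act l κ μ ε u ≤ 1 / 2 * ‖u‖ ^ 2 - l / 2 * D.m u - D.Ψ u := by
  have := mul_nonneg hκ (softPos_nonneg hε (D.m u - μ))
  unfold act; linarith

/-- Bounding the penalty by its asymptote turns the frequency into `l + 2κ` at the price of the
constant `κμ`; useful for masses that are not small compared with `μ`. -/
theorem act_le' {l κ μ ε : ℝ} (hκ : 0 ≤ κ) (hε : 0 < ε) (u : H) :
    D.act l κ μ ε u ≤
      1 / 2 * ‖u‖ ^ 2 - (l + 2 * κ) / 2 * D.m u - D.Ψ u + κ * μ + κ * ε / 2 := by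
  have := mul_le_mul_of_nonneg_left (sub_le_softPos hε (D.m u - μ)) hκ
  unfold act; linarith

theorem le_act {l κ μ ε : ℝ} (hκ : 0 ≤ κ) (hε : 0 < ε) (u : H) :
    1 / 2 * ‖u‖ ^ 2 - l / 2 * D.m u - D.Ψ u - κ * (ramp ε (D.m u - μ) * (D.m u - μ)) ≤
      D.act l κ μ ε u := by
  have := mul_le_mul_of_nonneg_left (softPos_le_ramp_mul hε (D.m u - μ)) hκ
  unfold act; linarith

/-- The penalized action controls the norm of almost critical points. -/
theorem norm_sq_le_act {l κ μ ε a : ℝ} (hκ : 0 ≤ κ) (hε : 0 < ε) (hμ : 0 ≤ μ) (hp : 2 < p)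
    (ha : ∀ u, a * ‖u‖ ^ 2 ≤ ‖u‖ ^ 2 - (l + 2 * κ) * D.m u) (u : H) :
    (p / 2 - 1) * (a * ‖u‖ ^ 2) ≤ p * D.act l κ μ ε u + ‖D.dact l κ μ ε u‖ * ‖u‖ := by
  -- In `p` times the action minus the pairing of its gradient with `u`, the terms in `Ψ` cancel.
  -- What remains is bounded below by `(p/2 - 1)(‖u‖² - (l + 2κ ramp) m u) + p κ ramp μ`, and `ramp
  -- ≤ 1` leads to the frequency `l + 2κ`, where coercivity is assumed.
  have h1 := D.le_act (l := l) (μ := μ) hκ hε u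
  have h2 : ⟪D.dact l κ μ ε u, u⟫ =
      ‖u‖ ^ 2 - (l + 2 * κ * ramp ε (D.m u - μ)) * D.m u - p * D.Ψ u := by
    simp only [dact, freq, inner_sub_left, real_inner_smul_left, real_inner_self_eq_norm_sq,
      D.euler]
    rfl
  have h3 := neg_le_of_abs_le (abs_real_inner_le_norm (D.dact l κ μ ε u) u)
  have h4 := mul_le_mul_of_nonneg_left h1 (by linarith : 0 ≤ p)
  have h5 : ramp ε (D.m u - μ) * (D.m u) * κ ≤ D.m u * κ := by
    have := mul_le_mul_of_nonneg_right (ramp_le_one ε (D.m u - μ)) (mul_nonneg (D.m_nonneg u) hκ)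
    linarith
  have h6 := mul_nonneg (mul_nonneg (ramp_nonneg ε (D.m u - μ)) hμ) hκ
  have h6' := mul_nonneg (by linarith : 0 ≤ p) h6
  have h7 := mul_le_mul_of_nonneg_left (ha u) (by linarith : 0 ≤ p / 2 - 1)
  have h8 := mul_le_mul_of_nonneg_left h5 (by linarith : 0 ≤ p - 2)
  linarith

/-- Mountain pass geometry near the origin. -/
theorem exists_ring {l κ μ a : ℝ} (ha : 0 < a) (hμ : 0 < μ) (hp : 2 < p)
    (hl : ∀ u, a * ‖u‖ ^ 2 ≤ ‖u‖ ^ 2 - l * D.m u) {b : ℝ} (hb : 0 < b) :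
    ∃ r h : ℝ, 0 < r ∧ r ≤ b ∧ 0 < h ∧
      ∀ ε, 0 < ε → ∀ u, ‖u‖ = r → h ≤ D.act l κ μ ε u := by
  obtain ⟨C, hC, hΨ⟩ := D.bound
  have hlim : Tendsto (fun r : ℝ => C * r ^ (p - 2)) (𝓝 0) (𝓝 0) := by
    have : ContinuousAt (fun r : ℝ => C * r ^ (p - 2)) 0 :=
      continuousAt_const.mul (Real.continuousAt_rpow_const _ _ (Or.inr (by linarith)))
    simpa [ContinuousAt, Real.zero_rpow (by linarith : p - 2 ≠ 0)] using this
  have hev := hlim.eventually_lt_const (show 0 < a / 4 by positivity)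
  obtain ⟨δ, hδ, hball⟩ := Metric.eventually_nhds_iff.1 hev
  -- Since `r ≤ 1` and `r ≤ μ`, one has `r² ≤ μ`: the penalty vanishes on this sphere, and `r` and
  -- `h` do not depend on `ε`.
  set r := min (min (δ / 2) b) (min 1 μ) with hr
  have hr0 : 0 < r := by positivity
  have hrδ : r < δ := lt_of_le_of_lt ((min_le_left _ _).trans (min_le_left _ _)) (by linarith)
  refine ⟨r, a / 4 * r ^ 2, hr0, (min_le_left _ _).trans (min_le_right _ _), by positivity, ?_⟩
  intro ε hε u hu
  have hm : D.m u ≤ μ := by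
    refine (D.le_sq u).trans ?_
    rw [hu]
    have h1 : r ≤ 1 := (min_le_right _ _).trans (min_le_left _ _)
    have h2 : r ≤ μ := (min_le_right _ _).trans (min_le_right _ _)
    nlinarith
  have h0 : softPos ε (D.m u - μ) = 0 := by
    rw [softPos, ramp_of_nonpos hε (by linarith)]; ring
  have h1 := hl u
  have h2 := hΨ u
  have h3 : C * r ^ p ≤ a / 4 * r ^ 2 := by
    have : r ^ p = r ^ (p - 2) * r ^ 2 := by
      rw [← Real.rpow_natCast r 2, ← Real.rpow_add hr0]
      norm_num
    rw [this, ← mul_assoc]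
    have hb' := (hball (y := r) (by simpa [abs_of_pos hr0] using hrδ)).le
    gcongr
  rw [hu] at h1 h2
  unfold act
  rw [h0, hu]
  linarith

/-- Along the ray through an optimizer `φ` of the Rayleigh quotient the penalized action stays
below the level `κ μ`, if the penalized frequency `l + 2 κ = Λ - η` is close to `Λ`. -/
theorem act_ray_le {l κ μ η Λ : ℝ} {φ : H} (hp : 2 < p) (hμ : 0 < μ) (hκ : 0 < κ)
    (hη : 0 < η) (hl : l + 2 * κ = Λ - η) (hηκ : η ≤ κ) (hφm : D.m φ = 1)
    (hφ : ‖φ‖ ^ 2 = Λ) (hηΨ : η ≤ (μ / 2) ^ ((p - 2) / 2) * D.Ψ φ) {ε : ℝ} (hε : 0 < ε)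
    (hεη : κ * ε ≤ η * μ / 4) {t : ℝ} (ht : 0 ≤ t) :
    D.act l κ μ ε (t • φ) ≤ max (3 / 4 * κ * μ) (κ * μ - η * μ / 8) := by
  have hn : ‖t • φ‖ ^ 2 = t ^ 2 * Λ := by
    rw [norm_smul, mul_pow, hφ, Real.norm_of_nonneg ht]
  have hm : D.m (t • φ) = t ^ 2 := by rw [D.m_smul, hφm, mul_one]
  -- For `t² ≤ μ/2` the penalty is dropped and `η ≤ κ` gives `3κμ/4`. For larger `t` the asymptotic
  -- bound applies and `t^p Ψ φ ≥ η t²` outweighs the quadratic part `η t² / 2`; the surplus, at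
  -- least `ημ/4`, absorbs the smoothing error `κε/2 ≤ ημ/8`.
  rcases le_total (t ^ 2) (μ / 2) with h | h
  · refine le_trans ?_ (le_max_left _ _)
    refine (D.act_le hκ.le hε _).trans ?_
    rw [hn, hm]
    have h1 := D.nonneg (t • φ)
    have h2 : Λ - l = 2 * κ + η := by linarith
    have h3 : 1 / 2 * (t ^ 2 * Λ) - l / 2 * t ^ 2 = t ^ 2 * (2 * κ + η) / 2 := by
      rw [← h2]; ring
    have h4 : t ^ 2 * (2 * κ + η) / 2 ≤ μ / 2 * (2 * κ + κ) / 2 := by gcongr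
    linarith
  · refine le_trans ?_ (le_max_right _ _)
    refine (D.act_le' hκ.le hε _).trans ?_
    rw [hn, hm, hl, D.hom t φ ht]
    have ht0 : 0 < t := by
      rcases ht.eq_or_lt with rfl | h0
      · norm_num at h; linarith
      · exact h0
    have h1 : t ^ p = (t ^ 2) ^ ((p - 2) / 2) * t ^ 2 := by
      rw [← Real.rpow_natCast t 2, ← Real.rpow_mul ht, ← Real.rpow_add ht0]
      congr 1; push_cast; ring
    have h2 : (μ / 2) ^ ((p - 2) / 2) ≤ (t ^ 2) ^ ((p - 2) / 2) := by
      apply Real.rpow_le_rpow (by positivity) h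
      linarith
    have h3 : η * t ^ 2 ≤ t ^ p * D.Ψ φ := by
      rw [h1]
      have := mul_le_mul_of_nonneg_right h2 (D.nonneg φ)
      nlinarith [sq_nonneg t]
    have h4 : η * (μ / 2) ≤ η * t ^ 2 := by gcongr
    linarith

/-- For `p > 2` the nonlinear term wins far out on the ray. The penalty only lowers the action, so
one `R` serves every `ε`. -/
theorem exists_act_neg {l κ μ : ℝ} {φ : H} (hp : 2 < p) (hκ : 0 ≤ κ) (hφ : 0 < D.Ψ φ) :
    ∃ R : ℝ, 0 < R ∧ ∀ ε, 0 < ε → D.act l κ μ ε (R • φ) < 0 := by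
  have hlim : Tendsto (fun t : ℝ => t ^ (p - 2)) atTop atTop :=
    tendsto_rpow_atTop (by linarith)
  set B := (1 / 2 * ‖φ‖ ^ 2 - l / 2 * D.m φ) / D.Ψ φ with hB
  obtain ⟨R, h1, h2⟩ := ((hlim.eventually_gt_atTop B).and (eventually_gt_atTop 0)).exists
  refine ⟨R, h2, fun ε hε => (D.act_le hκ hε _).trans_lt ?_⟩
  rw [D.hom R φ h2.le, D.m_smul, norm_smul, mul_pow, Real.norm_of_nonneg h2.le]
  have h3 : R ^ p = R ^ (p - 2) * R ^ 2 := by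
    rw [← Real.rpow_natCast R 2, ← Real.rpow_add h2]
    norm_num
  rw [hB, div_lt_iff₀ hφ] at h1
  rw [h3]
  nlinarith [mul_lt_mul_of_pos_right h1 (by positivity : 0 < R ^ 2)]

/-- Almost critical points of penalized actions converge along a subsequence. -/
theorem exists_tendsto_of_almost_critical [CompleteSpace H] {l κ μ a c : ℝ} (hκ : 0 ≤ κ)
    (hμ : 0 ≤ μ) (hp : 2 < p) (ha : 0 < a)
    (hco : ∀ t ≤ l + 2 * κ, ∀ u, a * ‖u‖ ^ 2 ≤ ‖u‖ ^ 2 - t * D.m u) {ε : ℕ → ℝ}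
    (hε : ∀ n, 0 < ε n) (hε0 : Tendsto ε atTop (𝓝 0)) {u : ℕ → H}
    (hc : ∀ n, D.act l κ μ (ε n) (u n) ≤ c) (hd : ∀ n, ‖D.dact l κ μ (ε n) (u n)‖ ≤ ε n) :
    ∃ (w : H) (s : ℝ) (k : ℕ → ℕ), StrictMono k ∧ Tendsto (u ∘ k) atTop (𝓝 w) ∧
      Tendsto (fun n => ramp (ε (k n)) (D.m (u (k n)) - μ)) atTop (𝓝 s) ∧ s ∈ Set.Icc (0 : ℝ) 1 ∧
      w - (l + 2 * κ * s) • D.S w - D.g w = 0 := by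
  obtain ⟨M, hM⟩ : ∃ M, ∀ n, ε n ≤ M := by
    obtain ⟨M, hM⟩ := hε0.bddAbove_range
    exact ⟨M, fun n => hM ⟨n, rfl⟩⟩
  obtain ⟨R, hR⟩ : ∃ R, ∀ n, ‖u n‖ ≤ R := by
    set q := (p / 2 - 1) * a with hq
    have hq0 : 0 < q := mul_pos (by linarith) ha
    refine ⟨(p * |c| + M) / q + 1, fun n => ?_⟩
    have h1 := D.norm_sq_le_act (l := l) (μ := μ) hκ (hε n) hμ hp (hco _ le_rfl) (u n)
    have h2 : ‖D.dact l κ μ (ε n) (u n)‖ * ‖u n‖ ≤ M * ‖u n‖ := by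
      have := (hd n).trans (hM n)
      gcongr
    have h3 : p * D.act l κ μ (ε n) (u n) ≤ p * |c| := by
      have := (hc n).trans (le_abs_self c)
      gcongr
    have h4 : q * ‖u n‖ ^ 2 ≤ p * |c| + M * ‖u n‖ := by
      rw [hq]; linarith
    have hM0 : 0 ≤ M := (hε 0).le.trans (hM 0)
    by_contra! hlt
    have h5 : 1 ≤ ‖u n‖ := by
      have : 0 ≤ (p * |c| + M) / q := by positivity
      linarith
    have h6 : p * |c| + M < q * ‖u n‖ := by
      have : (p * |c| + M) / q < ‖u n‖ := by linarith
      rwa [div_lt_iff₀' hq0] at this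
    have h7 : 0 ≤ p * |c| := by positivity
    nlinarith
  obtain ⟨K, hK, hgK⟩ := D.compact R
  obtain ⟨⟨y, s⟩, hys, k, hk, hlim⟩ := (hK.prod (isCompact_Icc (a := (0 : ℝ)) (b := 1))).tendsto_subseq
    (x := fun n => (D.g (u n), ramp (ε n) (D.m (u n) - μ)))
    fun n => ⟨hgK _ (hR n), ramp_nonneg _ _, ramp_le_one _ _⟩
  have hs : s ∈ Set.Icc (0 : ℝ) 1 := hys.2
  have hlg : Tendsto (fun n => D.g (u (k n))) atTop (𝓝 y) := (continuous_fst.tendsto _).comp hlim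
  have hls : Tendsto (fun n => ramp (ε (k n)) (D.m (u (k n)) - μ)) atTop (𝓝 s) :=
    (continuous_snd.tendsto _).comp hlim
  -- Compactness makes `g (u n)` and the ramp values converge along a subsequence, hence so does `L
  -- (u n)` for the linear part at the limiting frequency. Coercivity of `L` transfers the Cauchy
  -- property back to `u n`.
  set L : H →L[ℝ] H := ContinuousLinearMap.id ℝ H - (l + 2 * κ * s) • D.S with hL
  have hLlow : ∀ v, a * ‖v‖ ≤ ‖L v‖ := by
    intro v
    rcases eq_or_ne v 0 with rfl | hv
    · simp
    have h1 : a * ‖v‖ ^ 2 ≤ ⟪L v, v⟫ := by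
      have : ⟪L v, v⟫ = ‖v‖ ^ 2 - (l + 2 * κ * s) * D.m v := by
        simp [hL, inner_sub_left, real_inner_smul_left, m]
      rw [this]
      exact hco _ (by nlinarith [hs.2]) v
    have h2 := h1.trans (real_inner_le_norm _ _)
    have h3 : 0 < ‖v‖ := norm_pos_iff.2 hv
    by_contra! hlt
    nlinarith
  have hzero : Tendsto (fun n => D.dact l κ μ (ε (k n)) (u (k n)) +
      (2 * κ * (ramp (ε (k n)) (D.m (u (k n)) - μ) - s)) • D.S (u (k n)) + D.g (u (k n)))
      atTop (𝓝 y) := by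
    have h1 : Tendsto (fun n => D.dact l κ μ (ε (k n)) (u (k n))) atTop (𝓝 0) :=
      squeeze_zero_norm (fun n => hd (k n)) (hε0.comp hk.tendsto_atTop)
    have h2 : Tendsto (fun n => (2 * κ * (ramp (ε (k n)) (D.m (u (k n)) - μ) - s)) •
        D.S (u (k n))) atTop (𝓝 0) := by
      refine Tendsto.zero_smul_isBoundedUnder_le ?_ ?_
      · have := (hls.sub_const s).const_mul (2 * κ)
        simpa using this
      · refine isBoundedUnder_of ⟨‖D.S‖ * R, fun n => ?_⟩
        exact (D.S.le_opNorm _).trans (by gcongr; exact hR _)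
    simpa using (h1.add h2).add hlg
  have hLu : Tendsto (fun n => L (u (k n))) atTop (𝓝 y) := by
    refine hzero.congr fun n => ?_
    simp only [dact, freq, hL, sub_apply, ContinuousLinearMap.id_apply, smul_apply]
    module
  have hcau : CauchySeq (u ∘ k) := by
    have h1 := hLu.cauchySeq
    rw [Metric.cauchySeq_iff] at h1 ⊢
    intro δ hδ
    obtain ⟨N, hN⟩ := h1 (a * δ) (by positivity)
    refine ⟨N, fun i hi j hj => ?_⟩
    have h2 := hN i hi j hj
    rw [dist_eq_norm, ← map_sub] at h2
    rw [dist_eq_norm]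
    exact lt_of_mul_lt_mul_left ((hLlow _).trans_lt h2) ha.le
  obtain ⟨w, hw⟩ := cauchySeq_tendsto_of_complete hcau
  refine ⟨w, s, k, hk, hw, hls, hs, ?_⟩
  have h1 : L w = y := tendsto_nhds_unique ((L.continuous.tendsto w).comp hw) hLu
  have h2 : D.g w = y := tendsto_nhds_unique ((D.cont.tendsto w).comp hw) hlg
  rw [h2, ← h1]
  simp [hL]

/-- Existence of solutions with prescribed mass `μ`, or with prescribed frequency `l` and mass
below `μ`. -/
theorem exists_solution [CompleteSpace H] (hp : 2 < p) {Λ : ℝ}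
    (hΛ : ∀ u, Λ * D.m u ≤ ‖u‖ ^ 2) {φ : H} (hφ : ‖φ‖ ^ 2 = Λ * D.m φ) (hφΨ : 0 < D.Ψ φ)
    {μ : ℝ} (hμ : 0 < μ) {l : ℝ} (hl : l < Λ) :
    ∃ (w : H) (t : ℝ), w - t • D.S w - D.g w = 0 ∧
      ((D.m w = μ ∧ t < Λ) ∨ (0 < D.m w ∧ D.m w < μ ∧ t = l)) := by
  have hφ0 : φ ≠ 0 := by
    rintro rfl
    have := D.euler 0
    rw [inner_zero_right] at this
    have : D.Ψ 0 = 0 := by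
      rcases mul_eq_zero.1 this.symm with h | h
      · linarith
      · exact h
    linarith
  wlog hφm : D.m φ = 1 generalizing φ
  · have hm : 0 < D.m φ := D.pos φ hφ0
    have hs : 0 < (Real.sqrt (D.m φ))⁻¹ := by positivity
    have hs2 : (Real.sqrt (D.m φ))⁻¹ ^ 2 * D.m φ = 1 := by
      rw [inv_pow, Real.sq_sqrt hm.le, inv_mul_cancel₀ hm.ne']
    refine this (φ := (Real.sqrt (D.m φ))⁻¹ • φ) ?_ ?_ (smul_ne_zero hs.ne' hφ0) ?_
    · rw [norm_smul, mul_pow, Real.norm_of_nonneg hs.le, D.m_smul, hφ]; ring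
    · rw [D.hom _ _ hs.le]; positivity
    · rw [D.m_smul, hs2]
  rw [hφm, mul_one] at hφ
  have hΛ1 : 1 ≤ Λ := by
    have := D.le_sq φ
    rw [hφ] at this
    exact hφm.symm.le.trans this
  -- The first bound is what the ray estimate needs; `3η ≤ Λ - l` gives `κ ≥ η`, and `η ≤ Λ` makes
  -- the coercivity constant `η / Λ` at most `1`.
  obtain ⟨η, hη, hη1, hη2, hη3⟩ : ∃ η, 0 < η ∧ η ≤ (μ / 2) ^ ((p - 2) / 2) * D.Ψ φ ∧
      3 * η ≤ Λ - l ∧ η ≤ Λ := by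
    refine ⟨min ((μ / 2) ^ ((p - 2) / 2) * D.Ψ φ) (min ((Λ - l) / 3) Λ), ?_, min_le_left _ _,
      ?_, (min_le_right _ _).trans (min_le_right _ _)⟩
    · refine lt_min (by positivity) (lt_min ?_ ?_) <;> linarith
    · have := (min_le_right ((μ / 2) ^ ((p - 2) / 2) * D.Ψ φ) _).trans
        (min_le_left ((Λ - l) / 3) Λ)
      linarith
  set κ := (Λ - η - l) / 2 with hκdef
  have hκη : η ≤ κ := by rw [hκdef]; linarith
  have hκ : 0 < κ := hη.trans_le hκη
  have hlκ : l + 2 * κ = Λ - η := by rw [hκdef]; ring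
  set a := η / Λ with hadef
  have ha : 0 < a := by positivity
  have hco : ∀ t ≤ l + 2 * κ, ∀ u, a * ‖u‖ ^ 2 ≤ ‖u‖ ^ 2 - t * D.m u := by
    intro t ht u
    rw [hlκ] at ht
    have h1 := mul_le_mul_of_nonneg_right ht (D.m_nonneg u)
    have h2 : (Λ - η) * D.m u ≤ (1 - a) * ‖u‖ ^ 2 := by
      have h3 : Λ - η = (1 - a) * Λ := by rw [hadef]; field_simp
      have h4 : 0 ≤ 1 - a := by
        rw [hadef, sub_nonneg, div_le_one (by linarith)]; exact hη3
      rw [h3, mul_assoc]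
      exact mul_le_mul_of_nonneg_left (hΛ u) h4
    linarith
  set c := max (3 / 4 * κ * μ) (κ * μ - η * μ / 8) with hcdef
  have hcκ : c < κ * μ := by
    have := mul_pos hκ hμ
    have := mul_pos hη hμ
    exact max_lt (by linarith) (by linarith)
  obtain ⟨R, hR, hRneg⟩ := D.exists_act_neg (l := l) (κ := κ) (μ := μ) hp hκ.le hφΨ
  have hRφ : 0 < ‖R • φ‖ := norm_pos_iff.2 (smul_ne_zero hR.ne' hφ0)
  obtain ⟨r, h, hr, hrb, hh, hring⟩ :=
    D.exists_ring (κ := κ) ha hμ hp (hco l (by linarith)) hRφ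
  -- The prefactor is the largest smoothing scale allowed by the ray estimate. The same `ε n` also
  -- serves as the tolerance on the gradient.
  set ε : ℕ → ℝ := fun n => η * μ / (4 * κ) * (1 / ((n : ℝ) + 1)) with hεdef
  have hε : ∀ n, 0 < ε n := fun n => by positivity
  have hε0 : Tendsto ε atTop (𝓝 0) := by
    have := (tendsto_one_div_add_atTop_nhds_zero_nat (𝕜 := ℝ)).const_mul (η * μ / (4 * κ))
    rwa [mul_zero] at this
  have hεη : ∀ n, κ * ε n ≤ η * μ / 4 := by
    intro n
    have h1 : 1 / ((n : ℝ) + 1) ≤ 1 := by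
      rw [div_le_one (by positivity)]
      linarith [(n.cast_nonneg : (0 : ℝ) ≤ n)]
    calc κ * ε n = η * μ / 4 * (1 / ((n : ℝ) + 1)) := by
          rw [hεdef]; field_simp
      _ ≤ η * μ / 4 * 1 := by gcongr
      _ = _ := mul_one _
  have hex : ∀ n, ∃ u, h ≤ D.act l κ μ (ε n) u ∧ D.act l κ μ (ε n) u ≤ c ∧
      ‖D.dact l κ μ (ε n) u‖ ≤ ε n := fun n =>
    exists_small_gradient_of_descent (by positivity) (D.continuous_act l κ μ (ε n))
      (D.continuous_dact l κ μ (ε n)) (by simp [dact, D.zero])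
      (fun u s hs => D.act_step_le hκ.le (hε n) u hs) hr (hring _ (hε n)) hrb
      ((hRneg _ (hε n)).trans hh)
      (fun t ht => by
        rw [smul_smul]
        exact D.act_ray_le hp hμ hκ hη hlκ hκη hφm hφ hη1 (hε n) (hεη n)
          (mul_nonneg ht.1 hR.le)) (hε n)
  choose u hu1 hu2 hu3 using hex
  obtain ⟨w, s, k, hk, hw, hs, hs01, hcrit⟩ :=
    D.exists_tendsto_of_almost_critical hκ.le hμ.le hp ha hco hε hε0 hu2 hu3
  have hεk : Tendsto (fun n => ε (k n)) atTop (𝓝 0) := hε0.comp hk.tendsto_atTop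
  have hmk : Tendsto (fun n => D.m (u (k n))) atTop (𝓝 (D.m w)) :=
    (D.continuous_m.tendsto w).comp hw
  have hcont : Continuous fun v => 1 / 2 * ‖v‖ ^ 2 - l / 2 * D.m v - D.Ψ v := by
    have h1 := D.continuous_m
    have h2 := D.continuous_Ψ
    fun_prop
  have hlim := (hcont.tendsto w).comp hw
  -- The action stays above the ring level `h > 0`, which is independent of `n`, whereas it would
  -- tend to a nonpositive value if `w` were `0`.
  have hw0 : w ≠ 0 := by
    rintro rfl
    have h1 : h ≤ 1 / 2 * ‖(0 : H)‖ ^ 2 - l / 2 * D.m 0 - D.Ψ 0 :=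
      ge_of_tendsto' hlim fun n => (hu1 (k n)).trans (D.act_le hκ.le (hε _) _)
    have h2 := D.nonneg 0
    simp [m] at h1
    linarith
  refine ⟨w, l + 2 * κ * s, hcrit, ?_⟩
  -- Away from mass `μ` the ramp is eventually constant along the sequence, `0` below and `1` above,
  -- and this determines `s`.
  rcases lt_trichotomy (D.m w) μ with hlt | heq | hgt
  · refine Or.inr ⟨D.pos w hw0, hlt, ?_⟩
    have : Tendsto (fun n => ramp (ε (k n)) (D.m (u (k n)) - μ)) atTop (𝓝 0) := by
      refine tendsto_const_nhds.congr' ?_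
      filter_upwards [hmk.eventually_lt_const hlt] with n hn
      rw [ramp_of_nonpos (hε _) (by linarith)]
    rw [tendsto_nhds_unique hs this]; ring
  · exact Or.inl ⟨heq, by nlinarith [hs01.2]⟩
  -- Here `s = 1`, and by the Euler identity the limiting action is `κμ + (p/2 - 1) Ψ w ≥ κμ`,
  -- against the level bound `c < κμ`.
  · exfalso
    have h1 : Tendsto (fun n => ramp (ε (k n)) (D.m (u (k n)) - μ)) atTop (𝓝 1) := by
      refine tendsto_const_nhds.congr' ?_
      have h2 : Tendsto (fun n => D.m (u (k n)) - μ - ε (k n)) atTop (𝓝 (D.m w - μ - 0)) :=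
        (hmk.sub_const μ).sub hεk
      filter_upwards [h2.eventually_const_lt (show 0 < D.m w - μ - 0 by linarith)] with n hn
      rw [ramp_of_ge (hε _) (by linarith)]
    obtain rfl := tendsto_nhds_unique hs h1
    have h2 : 1 / 2 * ‖w‖ ^ 2 - l / 2 * D.m w - D.Ψ w - κ * (1 * (D.m w - μ)) ≤ c :=
      le_of_tendsto' (hlim.sub ((h1.mul (hmk.sub_const μ)).const_mul κ)) fun n =>
        (D.le_act hκ.le (hε _) _).trans (hu2 (k n))
    have h3 : ‖w‖ ^ 2 - (l + 2 * κ) * D.m w = p * D.Ψ w := by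
      have h4 : ⟪w - (l + 2 * κ * 1) • D.S w - D.g w, w⟫ = 0 := by rw [hcrit, inner_zero_left]
      simp only [inner_sub_left, real_inner_smul_left, real_inner_self_eq_norm_sq, D.euler,
        mul_one] at h4
      unfold m
      linarith
    have h5 := D.nonneg w
    nlinarith

end MassProblem

/-! ### Magnetic primitives on an interval -/

/-- The `L²` norm of `f` on `S`. -/
def l2norm (f : ℝ → ℂ) (S : Set ℝ) : ℝ := (eLpNorm f 2 (volume.restrict S)).toReal

theorem l2norm_nonneg (f : ℝ → ℂ) (S : Set ℝ) : 0 ≤ l2norm f S := ENNReal.toReal_nonneg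

theorem intervalIntegral_norm_le_l2norm {f : ℝ → ℂ} {S : Set ℝ} (hf : MemLp f 2 (volume.restrict S))
    {x y : ℝ} (hxy : x ≤ y) (hS : Set.Ioc x y ⊆ S) :
    ∫ t in x..y, ‖f t‖ ≤ Real.sqrt (y - x) * l2norm f S := by
  have hm : MemLp f 2 (volume.restrict (Set.Ioc x y)) :=
    hf.mono_measure (Measure.restrict_mono hS le_rfl)
  rw [intervalIntegral.integral_of_le hxy, integral_norm_eq_lintegral_enorm hm.1,
    ← eLpNorm_one_eq_lintegral_enorm]
  have h1 : eLpNorm f 1 (volume.restrict (Set.Ioc x y)) ≤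
      eLpNorm f 2 (volume.restrict S) * ENNReal.ofReal (Real.sqrt (y - x)) := by
    refine (eLpNorm_le_eLpNorm_mul_rpow_measure_univ (p := 1) (q := 2) (by norm_num) hm.1).trans ?_
    refine mul_le_mul' (eLpNorm_mono_measure f (Measure.restrict_mono hS le_rfl)) ?_
    rw [Measure.restrict_apply_univ, Real.volume_Ioc, Real.sqrt_eq_rpow,
      ENNReal.ofReal_rpow_of_nonneg (by linarith) (by norm_num)]
    norm_num
  refine (ENNReal.toReal_mono (ENNReal.mul_ne_top hf.2.ne ENNReal.ofReal_ne_top) h1).trans ?_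
  rw [ENNReal.toReal_mul, ENNReal.toReal_ofReal (Real.sqrt_nonneg _), mul_comm]
  rfl

/-- `f` is a primitive of `i (g + A f)` on `[0, R]`, where `f` is continuous and `g ∈ L²`. -/
structure IsMagPrimitive (A : ℝ → ℝ) (R : ℝ) (f g : ℝ → ℂ) : Prop where
  cont : ContinuousOn f (Set.Icc 0 R)
  memLp : MemLp g 2 (volume.restrict (Set.Icc 0 R))
  eq : ∀ x ∈ Set.Icc 0 R, f x = f 0 + ∫ t in (0 : ℝ)..x, Complex.I * (g t + A t * f t)

theorem MeasureTheory.MemLp.intervalIntegrable_two {E : Type*} [NormedAddCommGroup E] {f : ℝ → E}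
    {R x y : ℝ} (hf : MemLp f 2 (volume.restrict (Set.Icc 0 R))) (hx : x ∈ Set.Icc 0 R)
    (hy : y ∈ Set.Icc 0 R) : IntervalIntegrable f volume x y := by
  have h : IntegrableOn f (Set.Icc 0 R) := hf.integrable (by norm_num)
  refine (h.mono_set ?_).intervalIntegrable
  exact Set.uIcc_subset_Icc hx hy

theorem IsMagPrimitive.intervalIntegrable {A : ℝ → ℝ} {R : ℝ} {f g : ℝ → ℂ}
    (hA : MemLp A 2 (volume.restrict (Set.Icc 0 R))) (h : IsMagPrimitive A R f g) {x y : ℝ}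
    (hx : x ∈ Set.Icc 0 R) (hy : y ∈ Set.Icc 0 R) :
    IntervalIntegrable (fun t => (A t : ℂ) * f t) volume x y := by
  have h1 : IntervalIntegrable (fun t => (A t : ℂ)) volume x y :=
    hA.ofReal.intervalIntegrable_two hx hy
  exact h1.mul_continuousOn (h.cont.mono (Set.uIcc_subset_Icc hx hy))

theorem IsMagPrimitive.norm_sub_le {A : ℝ → ℝ} {R : ℝ} {f g : ℝ → ℂ}
    (hA : MemLp A 2 (volume.restrict (Set.Icc 0 R))) (h : IsMagPrimitive A R f g) {x y M : ℝ}
    (hx : x ∈ Set.Icc 0 R) (hy : y ∈ Set.Icc 0 R) (hxy : x ≤ y)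
    (hM : ∀ t ∈ Set.Icc x y, ‖f t‖ ≤ M) :
    ‖f y - f x‖ ≤ Real.sqrt (y - x) * l2norm g (Set.Icc 0 R) + M * ∫ t in x..y, |A t| := by
  have h0 : (0 : ℝ) ∈ Set.Icc 0 R := ⟨le_rfl, hx.1.trans hx.2⟩
  have hsub : Set.Ioc x y ⊆ Set.Icc 0 R := fun t ht => ⟨hx.1.trans ht.1.le, ht.2.trans hy.2⟩
  have hi : ∀ {a b : ℝ}, a ∈ Set.Icc 0 R → b ∈ Set.Icc 0 R →
      IntervalIntegrable (fun t => Complex.I * (g t + A t * f t)) volume a b := fun ha hb =>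
    ((h.memLp.intervalIntegrable_two ha hb).add (h.intervalIntegrable hA ha hb)).const_mul _
  have h1 : f y - f x = ∫ t in x..y, Complex.I * (g t + A t * f t) := by
    rw [h.eq x hx, h.eq y hy, ← intervalIntegral.integral_interval_sub_left (hi h0 hy) (hi h0 hx)]
    ring
  have hg := (h.memLp.intervalIntegrable_two hx hy).norm
  have hAi : IntervalIntegrable (fun t => |A t|) volume x y :=
    (hA.intervalIntegrable_two hx hy).norm
  rw [h1]
  calc ‖∫ t in x..y, Complex.I * (g t + A t * f t)‖
      ≤ ∫ t in x..y, (‖g t‖ + M * |A t|) := by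
        refine intervalIntegral.norm_integral_le_of_norm_le hxy ?_ (hg.add (hAi.const_mul M))
        refine ae_of_all _ fun t ht => ?_
        rw [norm_mul, Complex.norm_I, one_mul]
        refine (norm_add_le _ _).trans ?_
        gcongr
        rw [norm_mul, Complex.norm_real, Real.norm_eq_abs, mul_comm]
        have := hM t ⟨ht.1.le, ht.2⟩
        gcongr
    _ = (∫ t in x..y, ‖g t‖) + M * ∫ t in x..y, |A t| := by
        rw [intervalIntegral.integral_add hg (hAi.const_mul M), intervalIntegral.integral_const_mul]
    _ ≤ _ := by
        gcongr
        exact intervalIntegral_norm_le_l2norm h.memLp hxy hsub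

/-- The primitive of `|A|` is uniformly continuous. -/
theorem exists_delta_integral_abs_lt {A : ℝ → ℝ} {R : ℝ} (hR : 0 ≤ R)
    (hA : MemLp A 2 (volume.restrict (Set.Icc 0 R))) {ε : ℝ} (hε : 0 < ε) :
    ∃ δ > 0, ∀ x ∈ Set.Icc 0 R, ∀ y ∈ Set.Icc 0 R, x ≤ y → y - x < δ →
      ∫ t in x..y, |A t| < ε := by
  have h0 : (0 : ℝ) ∈ Set.Icc 0 R := ⟨le_rfl, hR⟩
  have hint : ∀ {a b : ℝ}, a ∈ Set.Icc 0 R → b ∈ Set.Icc 0 R →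
      IntervalIntegrable (fun t => |A t|) volume a b := fun ha hb =>
    (hA.intervalIntegrable_two ha hb).norm
  have hc : ContinuousOn (fun x => ∫ t in (0 : ℝ)..x, |A t|) (Set.Icc 0 R) := by
    have := intervalIntegral.continuousOn_primitive_interval' (hint h0 ⟨hR, le_rfl⟩)
      (Set.left_mem_uIcc)
    rwa [Set.uIcc_of_le hR] at this
  have hu := isCompact_Icc.uniformContinuousOn_of_continuous hc
  rw [Metric.uniformContinuousOn_iff] at hu
  obtain ⟨δ, hδ, H⟩ := hu ε hε
  refine ⟨δ, hδ, fun x hx y hy hxy hlt => ?_⟩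
  have h1 := H x hx y hy (by rw [dist_comm, Real.dist_eq, abs_of_nonneg (by linarith)]; exact hlt)
  rw [dist_comm, Real.dist_eq,
    intervalIntegral.integral_interval_sub_left (hint h0 hy) (hint h0 hx)] at h1
  exact (le_abs_self _).trans_lt h1

/-- On a window of length `δ` where `∫ |A| < 1/2`, the potential contributes at most half the
maximum `M` of `‖f‖` to its oscillation. So `‖f‖ ≥ M/2 - √δ ‖g‖₂` on the whole window, and
integrating controls `M` by the `L²` norms. -/
theorem IsMagPrimitive.exists_norm_le {A : ℝ → ℝ} {R : ℝ} (hR : 0 < R)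
    (hA : MemLp A 2 (volume.restrict (Set.Icc 0 R))) :
    ∃ C, 0 ≤ C ∧ ∀ f g, IsMagPrimitive A R f g → ∀ x ∈ Set.Icc 0 R,
      ‖f x‖ ≤ C * (l2norm f (Set.Icc 0 R) + l2norm g (Set.Icc 0 R)) := by
  obtain ⟨δ', hδ', H⟩ := exists_delta_integral_abs_lt hR.le hA (show (0 : ℝ) < 1 / 2 by norm_num)
  set δ := min (δ' / 2) R with hδdef
  have hδ : 0 < δ := by positivity
  have hδ'' : δ < δ' := (min_le_left _ _).trans_lt (by linarith)
  have hδR : δ ≤ R := min_le_right _ _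
  refine ⟨2 * (Real.sqrt δ / δ + Real.sqrt δ), by positivity, fun f g h x hx => ?_⟩
  -- Left end of a window of length `δ` that contains `x` and stays inside `[0, R]`.
  set c := min x (R - δ)
  have hc0 : 0 ≤ c := le_min hx.1 (by linarith)
  have hcx : c ≤ x := min_le_left _ _
  have hxd : x ≤ c + δ := by
    rcases min_cases x (R - δ) with h | h <;> linarith [hx.2]
  have hdR : c + δ ≤ R := by linarith [min_le_right x (R - δ)]
  have hmem : ∀ {t}, t ∈ Set.Icc c (c + δ) → t ∈ Set.Icc 0 R := fun ht =>
    ⟨hc0.trans ht.1, ht.2.trans hdR⟩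
  have hcont : ContinuousOn f (Set.Icc c (c + δ)) := h.cont.mono fun t => hmem
  obtain ⟨z, hz, hzmax⟩ := isCompact_Icc.exists_isMaxOn ⟨x, hcx, hxd⟩ hcont.norm
  set M := ‖f z‖
  have hM : ∀ t ∈ Set.Icc c (c + δ), ‖f t‖ ≤ M := fun t ht => hzmax ht
  have hM0 : 0 ≤ M := norm_nonneg _
  set b := l2norm g (Set.Icc 0 R)
  have hb : 0 ≤ b := l2norm_nonneg _ _
  have key : ∀ x y, x ∈ Set.Icc c (c + δ) → y ∈ Set.Icc c (c + δ) → x ≤ y →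
      ‖f y - f x‖ ≤ Real.sqrt δ * b + M / 2 := by
    intro x y hx hy hxy
    have h1 := h.norm_sub_le hA (hmem hx) (hmem hy) hxy fun t ht =>
      hM t ⟨hx.1.trans ht.1, ht.2.trans hy.2⟩
    have h2 := (H x (hmem hx) y (hmem hy) hxy (by linarith [hx.1, hy.2])).le
    have h3 : Real.sqrt (y - x) ≤ Real.sqrt δ := Real.sqrt_le_sqrt (by linarith [hx.1, hy.2])
    calc _ ≤ _ := h1
      _ ≤ Real.sqrt δ * b + M * (1 / 2) := by gcongr
      _ = _ := by ring
  have key2 : ∀ y ∈ Set.Icc c (c + δ), M / 2 - Real.sqrt δ * b ≤ ‖f y‖ := by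
    intro y hy
    have h1 : ‖f z - f y‖ ≤ Real.sqrt δ * b + M / 2 := by
      rcases le_total y z with hyz | hyz
      · exact key y z hy hz hyz
      · rw [norm_sub_rev]; exact key z y hz hy hyz
    have h2 := norm_sub_norm_le (f z) (f y)
    change M - _ ≤ _ at h2
    linarith
  have hfm : MemLp f 2 (volume.restrict (Set.Icc 0 R)) := by
    obtain ⟨B, hB⟩ := isCompact_Icc.exists_bound_of_continuousOn h.cont
    refine MemLp.of_bound (h.cont.aestronglyMeasurable measurableSet_Icc) B ?_
    exact (ae_restrict_iff' measurableSet_Icc).2 (ae_of_all _ hB)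
  have hle : c ≤ c + δ := by linarith
  have h3 : δ * (M / 2 - Real.sqrt δ * b) ≤ ∫ t in c..(c + δ), ‖f t‖ := by
    have : ∫ t in c..(c + δ), (M / 2 - Real.sqrt δ * b) = δ * (M / 2 - Real.sqrt δ * b) := by
      rw [intervalIntegral.integral_const, add_sub_cancel_left, smul_eq_mul]
    rw [← this]
    refine intervalIntegral.integral_mono_on hle (by simp) ?_ key2
    exact (ContinuousOn.intervalIntegrable (by rw [Set.uIcc_of_le hle]; exact hcont)).norm
  have h4 := intervalIntegral_norm_le_l2norm hfm hle
    (fun t ht => hmem (Set.Ioc_subset_Icc_self ht))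
  rw [add_sub_cancel_left] at h4
  have h5 := h3.trans h4
  set a := l2norm f (Set.Icc 0 R)
  have ha : 0 ≤ a := l2norm_nonneg _ _
  have h6 : M / 2 - Real.sqrt δ * b ≤ Real.sqrt δ / δ * a := by
    rw [div_mul_eq_mul_div, le_div_iff₀ hδ]; linarith
  have h7 : 0 ≤ Real.sqrt δ / δ * b := by positivity
  have h8 : 0 ≤ Real.sqrt δ * a := by positivity
  have := hM x ⟨hcx, hxd⟩
  linarith

/-- Limits of magnetic primitives. -/
theorem IsMagPrimitive.eq_of_tendsto {A : ℝ → ℝ} {R : ℝ} (hR : 0 ≤ R)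
    (hA : MemLp A 2 (volume.restrict (Set.Icc 0 R))) {f g : ℝ → ℂ} {F Γ : ℕ → ℝ → ℂ}
    (h : ∀ n, IsMagPrimitive A R (F n) (Γ n)) (hg : MemLp g 2 (volume.restrict (Set.Icc 0 R)))
    (hΓ : Tendsto (fun n => l2norm (Γ n - g) (Set.Icc 0 R)) atTop (𝓝 0))
    (hF : TendstoUniformlyOn F f atTop (Set.Icc 0 R)) : IsMagPrimitive A R f g := by
  have hfc : ContinuousOn f (Set.Icc 0 R) :=
    hF.continuousOn (Eventually.of_forall fun n => (h n).cont).frequently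
  have h0 : (0 : ℝ) ∈ Set.Icc 0 R := ⟨le_rfl, hR⟩
  refine ⟨hfc, hg, fun x hx => ?_⟩
  have hAf : IntervalIntegrable (fun t => (A t : ℂ) * f t) volume 0 x :=
    (hA.ofReal.intervalIntegrable_two h0 hx).mul_continuousOn
      (hfc.mono (Set.uIcc_subset_Icc h0 hx))
  have hgi := hg.intervalIntegrable_two h0 hx
  have hAi : IntervalIntegrable (fun t => |A t|) volume 0 x :=
    (hA.intervalIntegrable_two h0 hx).norm
  have hlim : Tendsto (fun n => ∫ t in (0 : ℝ)..x, Complex.I * (Γ n t + A t * F n t)) atTop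
      (𝓝 (∫ t in (0 : ℝ)..x, Complex.I * (g t + A t * f t))) := by
    rw [tendsto_iff_norm_sub_tendsto_zero]
    rw [Metric.tendstoUniformlyOn_iff] at hF
    set B := ∫ t in (0 : ℝ)..x, |A t|
    have hB : 0 ≤ B := intervalIntegral.integral_nonneg hx.1 fun t _ => abs_nonneg _
    -- The error splits into the `L²` distance of the derivatives, by Cauchy–Schwarz, and `A (F n -
    -- f)`, by uniform convergence and integrability of `A`.
    have hest : ∀ ε > 0, ∀ᶠ n in atTop,
        ‖(∫ t in (0 : ℝ)..x, Complex.I * (Γ n t + A t * F n t)) -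
          ∫ t in (0 : ℝ)..x, Complex.I * (g t + A t * f t)‖ ≤
        Real.sqrt x * l2norm (Γ n - g) (Set.Icc 0 R) + ε * B := by
      intro ε hε
      filter_upwards [hF ε hε] with n hn
      have hΓi := (h n).memLp.intervalIntegrable_two h0 hx
      have hAF := (h n).intervalIntegrable hA h0 hx
      have hd : IntervalIntegrable (fun t => ‖(Γ n - g) t‖) volume 0 x := (hΓi.sub hgi).norm
      rw [← intervalIntegral.integral_sub ((hΓi.add hAF).const_mul _) ((hgi.add hAf).const_mul _)]
      calc _ ≤ ∫ t in (0 : ℝ)..x, (‖(Γ n - g) t‖ + ε * |A t|) := by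
            refine intervalIntegral.norm_integral_le_of_norm_le hx.1 ?_ (hd.add (hAi.const_mul ε))
            refine ae_of_all _ fun t ht => ?_
            have : Complex.I * (Γ n t + A t * F n t) - Complex.I * (g t + A t * f t) =
                Complex.I * ((Γ n - g) t + A t * (F n t - f t)) := by
              simp only [Pi.sub_apply]; ring
            rw [this, norm_mul, Complex.norm_I, one_mul]
            refine (norm_add_le _ _).trans ?_
            gcongr
            rw [norm_mul, Complex.norm_real, Real.norm_eq_abs, mul_comm]
            have h1 := (hn t ⟨ht.1.le, ht.2.trans hx.2⟩).le
            rw [dist_comm, dist_eq_norm] at h1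
            gcongr
        _ = (∫ t in (0 : ℝ)..x, ‖(Γ n - g) t‖) + ε * B := by
            rw [intervalIntegral.integral_add hd (hAi.const_mul ε),
              intervalIntegral.integral_const_mul]
        _ ≤ _ := by
            gcongr
            have := intervalIntegral_norm_le_l2norm ((h n).memLp.sub hg) hx.1
              (fun t ht => ⟨ht.1.le, ht.2.trans hx.2⟩)
            rwa [sub_zero] at this
    rw [Metric.tendsto_nhds]
    intro ε hε
    have h1 : Tendsto (fun n => Real.sqrt x * l2norm (Γ n - g) (Set.Icc 0 R) +
        ε / (2 * (B + 1)) * B) atTop (𝓝 (Real.sqrt x * 0 + ε / (2 * (B + 1)) * B)) :=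
      (hΓ.const_mul _).add_const _
    have h2 : Real.sqrt x * 0 + ε / (2 * (B + 1)) * B < ε := by
      rw [mul_zero, zero_add, div_mul_eq_mul_div, div_lt_iff₀ (by positivity)]
      nlinarith
    filter_upwards [hest (ε / (2 * (B + 1))) (by positivity), h1.eventually_lt_const h2] with n h3 h4
    rw [dist_zero_right, norm_norm]
    exact h3.trans_lt h4
  have hlhs : ∀ y ∈ Set.Icc 0 R, Tendsto (fun n => F n y) atTop (𝓝 (f y)) := fun y hy =>
    hF.tendsto_at hy
  exact tendsto_nhds_unique (hlhs x hx)
    (((hlhs 0 h0).add hlim).congr fun n => ((h n).eq x hx).symm)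

/-- The continuous primitive determines its magnetic derivative. -/
theorem IsMagPrimitive.ae_eq_zero {A : ℝ → ℝ} {R : ℝ} (hR : 0 ≤ R) {f g : ℝ → ℂ}
    (h : IsMagPrimitive A R f g) (hf : ∀ x ∈ Set.Icc 0 R, f x = 0) :
    g =ᵐ[volume.restrict (Set.Icc 0 R)] 0 := by
  have h0 : (0 : ℝ) ∈ Set.Icc 0 R := ⟨le_rfl, hR⟩
  have hi : IntervalIntegrable g volume 0 R := h.memLp.intervalIntegrable_two h0 ⟨hR, le_rfl⟩
  have hz : ∀ x ∈ Set.Icc 0 R, ∫ t in (0 : ℝ)..x, g t = 0 := by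
    intro x hx
    have h1 := h.eq x hx
    rw [hf x hx, hf 0 h0, zero_add] at h1
    have h2 : ∫ t in (0 : ℝ)..x, Complex.I * (g t + A t * f t) =
        ∫ t in (0 : ℝ)..x, Complex.I * g t := by
      refine intervalIntegral.integral_congr fun t ht => ?_
      rw [Set.uIcc_of_le hx.1] at ht
      simp only [hf t ⟨ht.1, ht.2.trans hx.2⟩, mul_zero, add_zero]
    rw [h2, intervalIntegral.integral_const_mul] at h1
    simpa using h1.symm
  -- Lebesgue differentiation recovers `g` from its vanishing primitive. The endpoints are discarded
  -- so that the primitive vanishes on a full neighbourhood of each point.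
  rw [EventuallyEq, ← restrict_Ioo_eq_restrict_Icc, ae_restrict_iff' measurableSet_Ioo]
  filter_upwards [hi.ae_hasDerivAt_integral] with x hx hxI
  have h1 := hx (by rw [Set.uIcc_of_le hR]; exact Set.Ioo_subset_Icc_self hxI) 0
    (by rw [Set.uIcc_of_le hR]; exact h0)
  have h2 : HasDerivAt (fun y => ∫ t in (0 : ℝ)..y, g t) 0 x := by
    refine (hasDerivAt_const x (0 : ℂ)).congr_of_eventuallyEq ?_
    filter_upwards [Ioo_mem_nhds hxI.1 hxI.2] with y hy
    exact hz y (Set.Ioo_subset_Icc_self hy)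
  exact h1.unique h2

/-! ### Continuous representatives and completeness of `H¹_A` -/

namespace MetricGraph

variable {Vert Bdd Half : Type*} (G : MetricGraph Vert Bdd Half) {A V : G.Pt → ℝ}

theorem measurableSet_interval (e : Bdd ⊕ Half) : MeasurableSet (G.interval e) := by
  rcases e with b | h
  · exact measurableSet_Icc
  · exact measurableSet_Ici

theorem measurable_mk (e : Bdd ⊕ Half) : Measurable (β := G.Pt) fun x : ℝ => ⟨e, x⟩ :=
  fun _ hs => MeasurableSpace.measurableSet_iInf.1 hs e

theorem measurableSet_pt {s : Set G.Pt} :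
    MeasurableSet s ↔ ∀ e, MeasurableSet {x : ℝ | (⟨e, x⟩ : G.Pt) ∈ s} :=
  MeasurableSpace.measurableSet_iInf

theorem map_le_vol (e : Bdd ⊕ Half) :
    (volume.restrict (G.interval e)).map (fun x => (⟨e, x⟩ : G.Pt)) ≤ G.vol :=
  Measure.le_sum _ e

theorem memLp_edge {E : Type*} [NormedAddCommGroup E] {f : G.Pt → E} (hf : MemLp f 2 G.vol)
    (e : Bdd ⊕ Half) {S : Set ℝ} (hS : S ⊆ G.interval e) :
    MemLp (fun x => f ⟨e, x⟩) 2 (volume.restrict S) := by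
  have h := (hf.mono_measure (G.map_le_vol e))
  exact (h.comp_of_map (G.measurable_mk e).aemeasurable).mono_measure
    (Measure.restrict_mono hS le_rfl)

theorem l2norm_edge_le {f : G.Pt → ℂ} (hf : MemLp f 2 G.vol) (e : Bdd ⊕ Half) {S : Set ℝ}
    (hS : S ⊆ G.interval e) :
    l2norm (fun x => f ⟨e, x⟩) S ≤ (eLpNorm f 2 G.vol).toReal := by
  refine ENNReal.toReal_mono hf.2.ne ?_
  have h := (hf.mono_measure (G.map_le_vol e))
  refine (eLpNorm_mono_measure _ (Measure.restrict_mono hS le_rfl)).trans ?_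
  refine le_trans ?_ (eLpNorm_mono_measure f (G.map_le_vol e))
  rw [eLpNorm_map_measure h.1 (G.measurable_mk e).aemeasurable]
  rfl

theorem memLp_edge_of_locally {A : G.Pt → ℝ}
    (hA : ∀ R : ℝ, MemLp A 2 (G.vol.restrict {q | q.2 ≤ R})) (e : Bdd ⊕ Half) {R : ℝ}
    (hR : Set.Icc 0 R ⊆ G.interval e) :
    MemLp (fun x => A ⟨e, x⟩) 2 (volume.restrict (Set.Icc 0 R)) := by
  have hm : MeasurableSet {q : G.Pt | q.2 ≤ R} :=
    G.measurableSet_pt.2 fun e => measurableSet_Iic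
  have h := (hA R).mono_measure (Measure.restrict_mono_measure (G.map_le_vol e) _)
  rw [Measure.restrict_map (G.measurable_mk e) hm] at h
  refine (h.comp_of_map (G.measurable_mk e).aemeasurable).mono_measure ?_
  rw [Measure.restrict_restrict (G.measurable_mk e hm)]
  refine Measure.restrict_mono ?_ le_rfl
  intro x hx
  exact ⟨hx.2, hR hx⟩

theorem ae_vol_iff [Finite Bdd] [Finite Half] {P : G.Pt → Prop} :
    (∀ᵐ q ∂G.vol, P q) ↔ ∀ e, ∀ᵐ x ∂(volume.restrict (G.interval e)), P ⟨e, x⟩ := by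
  refine ⟨fun h e => G.ae_edge h e, fun h => ?_⟩
  rw [vol, Measure.ae_sum_iff]
  intro e
  have hms : MeasurableEmbedding fun x : ℝ => (⟨e, x⟩ : G.Pt) := by
    refine ⟨fun x y hxy => by simpa using hxy, G.measurable_mk e, fun s hs => G.measurableSet_pt.2 fun e' => ?_⟩
    by_cases he : e = e'
    · subst he
      convert hs using 1
      ext x
      simp
    · convert MeasurableSet.empty using 1
      ext x
      simp [he]
  rw [hms.ae_map_iff]
  exact h e

theorem ae_mem_interval [Finite Bdd] [Finite Half] : ∀ᵐ q ∂G.vol, q.2 ∈ G.interval q.1 :=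
  G.ae_vol_iff.2 fun e => ae_restrict_mem (G.measurableSet_interval e)

theorem exists_Icc_subset_interval {e : Bdd ⊕ Half} {x : ℝ} (hx : x ∈ G.interval e) :
    ∃ R, 0 < R ∧ x ∈ Set.Icc 0 R ∧ Set.Icc 0 R ⊆ G.interval e ∧
      Set.Icc 0 R ∈ 𝓝[G.interval e] x := by
  rcases e with b | h
  · exact ⟨G.len b, G.len_pos b, hx, le_rfl, self_mem_nhdsWithin⟩
  · have hx0 : 0 ≤ x := hx
    refine ⟨x + 1, by linarith, ⟨hx, by linarith⟩, fun t ht => ht.1, ?_⟩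
    have : Set.Ici 0 ∩ Set.Iio (x + 1) ∈ 𝓝[Set.Ici 0] x :=
      inter_mem_nhdsWithin _ (Iio_mem_nhds (by linarith))
    exact mem_of_superset this fun t ht => ⟨ht.1, ht.2.le⟩

variable {G}

theorem le_volV (hV1 : ∀ᵐ q ∂G.vol, 1 ≤ V q) : G.vol ≤ G.volV V := by
  refine Measure.le_iff.2 fun s hs => ?_
  rw [volV, withDensity_apply _ hs, ← setLIntegral_one]
  refine lintegral_mono_ae (ae_restrict_of_ae ?_)
  filter_upwards [hV1] with q hq
  rw [← ENNReal.ofReal_one]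
  exact ENNReal.ofReal_le_ofReal hq

theorem ae_vol_of_ae_volV (hV1 : ∀ᵐ q ∂G.vol, 1 ≤ V q) {P : G.Pt → Prop}
    (h : ∀ᵐ q ∂G.volV V, P q) : ∀ᵐ q ∂G.vol, P q :=
  ae_mono (le_volV hV1) h

theorem ae_volV_of_ae_vol {P : G.Pt → Prop} (h : ∀ᵐ q ∂G.vol, P q) : ∀ᵐ q ∂G.volV V, P q :=
  (withDensity_absolutelyContinuous _ _).ae_le h

/-- `f` is the continuous representative of `U.fst`, and `U.snd` its magnetic derivative. -/
structure IsRep (A : G.Pt → ℝ) (U : G.Pairs V) (f : G.Pt → ℂ) : Prop where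
  isCont : G.IsCont f
  ae_eq : U.fst =ᵐ[G.volV V] f
  isMagDeriv : G.IsMagDeriv A f U.snd

theorem exists_isRep (u : G.H1A A V) : ∃ f, IsRep A (u : G.Pairs V) f := by
  obtain ⟨f, h1, h2, h3⟩ := u.2
  exact ⟨f, h1, h2, h3⟩

theorem IsRep.mem {U : G.Pairs V} {f : G.Pt → ℂ} (h : IsRep A U f) : U ∈ G.H1A A V :=
  ⟨f, h.1, h.2, h.3⟩

theorem IsRep.add {U U' : G.Pairs V} {f f' : G.Pt → ℂ} (h : IsRep A U f) (h' : IsRep A U' f') :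
    IsRep A (U + U') (f + f') := by
  refine ⟨⟨fun e => (h.1.1 e).add (h'.1.1 e), fun v q q' hq hq' => ?_⟩,
    (Lp.coeFn_add _ _).trans (h.2.add h'.2), (h.3.add G h'.3).congr G ?_⟩
  · simp only [Pi.add_apply, h.1.2 v q q' hq hq', h'.1.2 v q q' hq hq']
  · filter_upwards [Lp.coeFn_add U.snd U'.snd] with q hq
    simp only [WithLp.add_snd, hq, Pi.add_apply]
    ring

theorem IsRep.smul {U : G.Pairs V} {f : G.Pt → ℂ} (h : IsRep A U f) (c : ℂ) :
    IsRep A (c • U) (c • f) := by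
  refine ⟨⟨fun e => (h.1.1 e).const_smul c, fun v q q' hq hq' => ?_⟩,
    (Lp.coeFn_smul _ _).trans (h.2.const_smul c), (h.3.smul G c).congr G ?_⟩
  · simp only [Pi.smul_apply, h.1.2 v q q' hq hq']
  · filter_upwards [Lp.coeFn_smul c U.snd] with q hq
    simp only [WithLp.smul_snd, hq, Pi.smul_apply, smul_eq_mul]
    ring

theorem IsRep.sub {U U' : G.Pairs V} {f f' : G.Pt → ℂ} (h : IsRep A U f) (h' : IsRep A U' f') :
    IsRep A (U - U') (f - f') := by
  have := h.add (h'.smul (-1))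
  rwa [neg_one_smul, neg_one_smul, ← sub_eq_add_neg, ← sub_eq_add_neg] at this

theorem memLp_snd (U : G.Pairs V) : MemLp U.snd 2 G.vol := Lp.memLp _

theorem memLp_fst (hV1 : ∀ᵐ q ∂G.vol, 1 ≤ V q) (U : G.Pairs V) : MemLp U.fst 2 G.vol :=
  (Lp.memLp U.fst).mono_measure (le_volV hV1)

theorem norm_fst_le (U : G.Pairs V) : ‖U.fst‖ ≤ ‖U‖ := by
  have := WithLp.prod_norm_sq_eq_of_L2 U
  exact abs_le_of_sq_le_sq' (by nlinarith [sq_nonneg ‖U.snd‖]) (norm_nonneg _) |>.2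

theorem norm_snd_le (U : G.Pairs V) : ‖U.snd‖ ≤ ‖U‖ := by
  have := WithLp.prod_norm_sq_eq_of_L2 U
  exact abs_le_of_sq_le_sq' (by nlinarith [sq_nonneg ‖U.fst‖]) (norm_nonneg _) |>.2

theorem eLpNorm_fst_le (hV1 : ∀ᵐ q ∂G.vol, 1 ≤ V q) (U : G.Pairs V) :
    (eLpNorm U.fst 2 G.vol).toReal ≤ ‖U‖ := by
  refine le_trans ?_ (norm_fst_le U)
  rw [Lp.norm_def]
  exact ENNReal.toReal_mono (Lp.eLpNorm_ne_top _) (eLpNorm_mono_measure _ (le_volV hV1))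

theorem l2norm_snd_le (U : G.Pairs V) (e : Bdd ⊕ Half) {R : ℝ}
    (hR : Set.Icc 0 R ⊆ G.interval e) :
    l2norm (fun x => U.snd ⟨e, x⟩) (Set.Icc 0 R) ≤ ‖U‖ := by
  refine (G.l2norm_edge_le (memLp_snd U) e hR).trans ?_
  rw [← Lp.norm_def]
  exact norm_snd_le U

theorem IsRep.ae_eq_vol (hV1 : ∀ᵐ q ∂G.vol, 1 ≤ V q) {U : G.Pairs V} {f : G.Pt → ℂ}
    (h : IsRep A U f) : U.fst =ᵐ[G.vol] f := ae_vol_of_ae_volV hV1 h.2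

theorem IsRep.l2norm_le (hV1 : ∀ᵐ q ∂G.vol, 1 ≤ V q) {U : G.Pairs V} {f : G.Pt → ℂ}
    (h : IsRep A U f) (e : Bdd ⊕ Half) {R : ℝ} (hR : Set.Icc 0 R ⊆ G.interval e) :
    l2norm (fun x => f ⟨e, x⟩) (Set.Icc 0 R) ≤ ‖U‖ := by
  have hf := (memLp_fst hV1 U).ae_eq (h.ae_eq_vol hV1)
  refine (G.l2norm_edge_le hf e hR).trans ?_
  rw [← eLpNorm_congr_ae (h.ae_eq_vol hV1)]
  exact eLpNorm_fst_le hV1 U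

theorem IsRep.isMagPrimitive {U : G.Pairs V} {f : G.Pt → ℂ} (h : IsRep A U f) (e : Bdd ⊕ Half)
    {R : ℝ} (hR : Set.Icc 0 R ⊆ G.interval e) :
    IsMagPrimitive (fun x => A ⟨e, x⟩) R (fun x => f ⟨e, x⟩) (fun x => U.snd ⟨e, x⟩) :=
  ⟨(h.1.1 e).mono hR, G.memLp_edge (memLp_snd U) e hR, fun x hx => (h.3 e x (hR hx)).2⟩

theorem IsRep.exists_norm_le (hA : ∀ R : ℝ, MemLp A 2 (G.vol.restrict {q | q.2 ≤ R}))
    (hV1 : ∀ᵐ q ∂G.vol, 1 ≤ V q) (e : Bdd ⊕ Half) {R : ℝ} (hR0 : 0 < R)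
    (hR : Set.Icc 0 R ⊆ G.interval e) :
    ∃ C, 0 ≤ C ∧ ∀ (U : G.Pairs V) f, IsRep A U f → ∀ x ∈ Set.Icc 0 R, ‖f ⟨e, x⟩‖ ≤ C * ‖U‖ := by
  obtain ⟨C, hC, H⟩ := IsMagPrimitive.exists_norm_le hR0 (G.memLp_edge_of_locally hA e hR)
  refine ⟨C * 2, by positivity, fun U f h x hx => ?_⟩
  refine (H _ _ (h.isMagPrimitive e hR) x hx).trans ?_
  rw [mul_assoc]
  have h1 := h.l2norm_le hV1 e hR
  have h2 := l2norm_snd_le U e hR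
  gcongr
  linarith

/-- The continuous representative is unique. -/
theorem IsRep.eq_of_mem (hA : ∀ R : ℝ, MemLp A 2 (G.vol.restrict {q | q.2 ≤ R}))
    (hV1 : ∀ᵐ q ∂G.vol, 1 ≤ V q) {U : G.Pairs V} {f f' : G.Pt → ℂ}
    (h : IsRep A U f) (h' : IsRep A U f') {e : Bdd ⊕ Half} {x : ℝ} (hx : x ∈ G.interval e) :
    f ⟨e, x⟩ = f' ⟨e, x⟩ := by
  obtain ⟨R, hR0, hxR, hR, -⟩ := G.exists_Icc_subset_interval hx
  obtain ⟨C, hC, H⟩ := IsRep.exists_norm_le hA hV1 e hR0 hR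
  -- The difference `f - f'` represents `U - U = 0`, so the pointwise bound forces it to vanish.
  have h1 := H _ _ (h.sub h') x hxR
  rw [sub_self, norm_zero, mul_zero, norm_le_zero_iff] at h1
  exact sub_eq_zero.1 h1

/-- A function which is a magnetic primitive on compact intervals is a representative. -/
theorem isRep_of_isMagPrimitive (hA : ∀ R : ℝ, MemLp A 2 (G.vol.restrict {q | q.2 ≤ R}))
    {U : G.Pairs V} {f : G.Pt → ℂ}
    (hf : ∀ v q q', G.IsAt v q → G.IsAt v q' → f q = f q') (hU : U.fst =ᵐ[G.volV V] f)
    (h : ∀ e R, 0 < R → Set.Icc 0 R ⊆ G.interval e →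
      IsMagPrimitive (fun x => A ⟨e, x⟩) R (fun x => f ⟨e, x⟩) (fun x => U.snd ⟨e, x⟩)) :
    IsRep A U f := by
  refine ⟨⟨fun e x hx => ?_, hf⟩, hU, fun e x hx => ?_⟩
  · obtain ⟨R, hR0, hxR, hR, hnhds⟩ := G.exists_Icc_subset_interval hx
    exact ((h e R hR0 hR).cont x hxR).mono_of_mem_nhdsWithin hnhds
  · obtain ⟨R, hR0, hxR, hR, -⟩ := G.exists_Icc_subset_interval hx
    have hp := h e R hR0 hR
    have h0 : (0 : ℝ) ∈ Set.Icc 0 R := ⟨le_rfl, hR0.le⟩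
    exact ⟨((hp.memLp.intervalIntegrable_two h0 hxR).add
      (hp.intervalIntegrable (G.memLp_edge_of_locally hA e hR) h0 hxR)).const_mul _, hp.eq x hxR⟩

/-- The pointwise bound turns norm convergence into locally uniform convergence of the
representatives, which preserves continuity, gluing and the primitive relation. Completeness of
`H¹_A` follows from that of `Pairs`. -/
theorem isClosed_H1A [Finite Bdd] [Finite Half]
    (hA : ∀ R : ℝ, MemLp A 2 (G.vol.restrict {q | q.2 ≤ R}))
    (hV1 : ∀ᵐ q ∂G.vol, 1 ≤ V q) : IsClosed (G.H1A A V : Set (G.Pairs V)) := by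
  refine isClosed_of_closure_subset fun U hU => ?_
  obtain ⟨W, hW, hlim⟩ := mem_closure_iff_seq_limit.1 hU
  choose F hF using fun n => exists_isRep (⟨W n, hW n⟩ : G.H1A A V)
  have hcau : ∀ e R, 0 < R → Set.Icc 0 R ⊆ G.interval e →
      UniformCauchySeqOn (fun n x => F n ⟨e, x⟩) atTop (Set.Icc 0 R) := by
    intro e R hR0 hR
    obtain ⟨C, hC, H⟩ := IsRep.exists_norm_le hA hV1 e hR0 hR
    rw [Metric.uniformCauchySeqOn_iff]
    intro ε hε
    obtain ⟨N, hN⟩ := Metric.cauchySeq_iff.1 hlim.cauchySeq (ε / (C + 1)) (by positivity)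
    refine ⟨N, fun m hm n hn x hx => ?_⟩
    have h1 := H _ _ ((hF m).sub (hF n)) x hx
    have h2 := hN m hm n hn
    rw [dist_eq_norm, lt_div_iff₀ (by positivity)] at h2
    rw [dist_eq_norm]
    refine h1.trans_lt (lt_of_le_of_lt ?_ h2)
    change C * ‖W m - W n‖ ≤ _
    nlinarith [norm_nonneg (W m - W n)]
  set f : G.Pt → ℂ := fun q => limUnder atTop fun n => F n q with hf
  have hpt : ∀ e, ∀ x ∈ G.interval e, Tendsto (fun n => F n ⟨e, x⟩) atTop (𝓝 (f ⟨e, x⟩)) := by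
    intro e x hx
    obtain ⟨R, hR0, hxR, hR, -⟩ := G.exists_Icc_subset_interval hx
    have hc : CauchySeq fun n => F n ⟨e, x⟩ := (hcau e R hR0 hR).cauchySeq hxR
    exact hc.tendsto_limUnder
  -- The two sequences are equal term by term, so their limits agree without any appeal to
  -- convergence.
  have hglue : ∀ v q q', G.IsAt v q → G.IsAt v q' → f q = f q' := by
    intro v q q' hq hq'
    simp only [hf]
    congr 2
    funext n
    exact (hF n).1.2 v q q' hq hq'
  have hfst : Tendsto (fun n => (W n).fst) atTop (𝓝 U.fst) := by
    rw [tendsto_iff_norm_sub_tendsto_zero] at hlim ⊢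
    exact squeeze_zero (fun n => norm_nonneg _) (fun n => norm_fst_le (W n - U)) hlim
  -- An almost everywhere convergent subsequence identifies the `L²` limit with the pointwise limit.
  have hae : U.fst =ᵐ[G.volV V] f := by
    obtain ⟨k, hk, hkae⟩ := (tendstoInMeasure_of_tendsto_Lp hfst).exists_seq_tendsto_ae
    filter_upwards [hkae, ae_all_iff.2 fun n => (hF n).2,
      ae_volV_of_ae_vol G.ae_mem_interval] with q h1 h2 h3
    refine tendsto_nhds_unique h1 ?_
    refine ((hpt q.1 q.2 h3).comp hk.tendsto_atTop).congr fun n => ?_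
    exact (h2 (k n)).symm
  refine (isRep_of_isMagPrimitive hA hglue hae fun e R hR0 hR => ?_).mem
  refine IsMagPrimitive.eq_of_tendsto hR0.le (G.memLp_edge_of_locally hA e hR)
    (fun n => (hF n).isMagPrimitive e hR) (G.memLp_edge (memLp_snd U) e hR) ?_
    ((hcau e R hR0 hR).tendstoUniformlyOn_of_tendsto fun x hx => hpt e x (hR hx))
  rw [tendsto_iff_norm_sub_tendsto_zero] at hlim
  refine squeeze_zero (fun n => l2norm_nonneg _ _) (fun n => ?_) hlim
  refine le_trans (le_of_eq ?_) (l2norm_snd_le (W n - U) e hR)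
  refine congrArg ENNReal.toReal (eLpNorm_congr_ae ?_)
  refine ae_restrict_of_ae_restrict_of_subset hR ?_
  filter_upwards [G.ae_edge (Lp.coeFn_sub (W n).snd U.snd) e] with x hx
  exact hx.symm

end MetricGraph

/-! ### Power nonlinearity composed with a map into continuous functions -/

/-- The gradient `|z|^(p-2) z` of `|z|^p / p`. -/
def powGrad (p : ℝ) (z : ℂ) : ℂ := (‖z‖ ^ (p - 2) : ℝ) • z

theorem continuous_powGrad {p : ℝ} (hp : 2 < p) : Continuous (powGrad p) := by
  unfold powGrad
  exact (continuous_norm.rpow_const fun _ => Or.inr (by linarith)).smul continuous_id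

theorem norm_powGrad {p : ℝ} (hp : 2 < p) (z : ℂ) : ‖powGrad p z‖ = ‖z‖ ^ (p - 1) := by
  rw [powGrad, norm_smul, Real.norm_of_nonneg (by positivity)]
  rcases eq_or_ne z 0 with rfl | hz
  · rw [norm_zero, Real.zero_rpow (by linarith), mul_zero, Real.zero_rpow (by linarith)]
  · have := norm_pos_iff.2 hz
    rw [show p - 1 = p - 2 + 1 by ring, Real.rpow_add_one this.ne']

theorem inner_powGrad_self {p : ℝ} (hp : 2 < p) (z : ℂ) : ⟪powGrad p z, z⟫ = ‖z‖ ^ p := by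
  rw [powGrad, real_inner_smul_left, real_inner_self_eq_norm_sq]
  rcases eq_or_ne z 0 with rfl | hz
  · rw [norm_zero, Real.zero_rpow (by linarith), zero_mul, Real.zero_rpow (by linarith)]
  · have := norm_pos_iff.2 hz
    rw [← Real.rpow_natCast ‖z‖ 2, ← Real.rpow_add this]
    norm_num

/-- Young's inequality for `‖z‖^(p-1) ‖w‖` with exponents `p / (p - 1)` and `p`. -/
theorem powGrad_subgradient {p : ℝ} (hp : 2 < p) (z w : ℂ) :
    1 / p * ‖z‖ ^ p + (⟪powGrad p z, w⟫ - ‖z‖ ^ p) ≤ 1 / p * ‖w‖ ^ p := by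
  have hpq : (p / (p - 1)).HolderConjugate p :=
    (Real.HolderConjugate.conjExponent (by linarith : 1 < p)).symm
  have h1 : ⟪powGrad p z, w⟫ ≤ ‖z‖ ^ (p - 1) * ‖w‖ := by
    have := real_inner_le_norm (powGrad p z) w
    rwa [norm_powGrad hp] at this
  have h2 := Real.young_inequality_of_nonneg (a := ‖z‖ ^ (p - 1)) (b := ‖w‖) (by positivity)
    (norm_nonneg _) hpq
  have hp1 : p - 1 ≠ 0 := by linarith
  have hp0 : p ≠ 0 := by linarith
  rw [← Real.rpow_mul (norm_nonneg _), mul_div_cancel₀ _ hp1] at h2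
  have h3 : ‖z‖ ^ p / (p / (p - 1)) = ‖z‖ ^ p - 1 / p * ‖z‖ ^ p := by
    field_simp
  rw [h3] at h2
  have h4 : ‖w‖ ^ p / p = 1 / p * ‖w‖ ^ p := by ring
  linarith

section Nemytskii

variable {X : Type*} [TopologicalSpace X] {H : Type*} [NormedAddCommGroup H]
  [InnerProductSpace ℝ H] {p : ℝ} (hp : 2 < p)

/-- `u ↦ |T u|^(p-2) T u`. -/
def nemytskii (T : H →L[ℝ] C(X, ℂ)) (u : H) : C(X, ℂ) :=
  ContinuousMap.comp ⟨powGrad p, continuous_powGrad hp⟩ (T u)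

theorem nemytskii_apply (T : H →L[ℝ] C(X, ℂ)) (u : H) (x : X) :
    nemytskii hp T u x = powGrad p (T u x) := rfl

theorem continuous_nemytskii (T : H →L[ℝ] C(X, ℂ)) : Continuous (nemytskii hp T) :=
  (ContinuousMap.continuous_postcomp _).comp T.continuous

end Nemytskii

section Potential

variable {X : Type*} [TopologicalSpace X] [CompactSpace X] [MeasurableSpace X]
  [OpensMeasurableSpace X] (ν : Measure X) [IsFiniteMeasure ν]

theorem integrable_of_continuous_compact {f : X → ℝ} (hf : Continuous f) : Integrable f ν := by
  obtain ⟨C, hC⟩ := isCompact_univ.exists_bound_of_continuousOn hf.continuousOn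
  exact Integrable.of_bound hf.aestronglyMeasurable C (ae_of_all _ fun x => hC x (Set.mem_univ x))

/-- The real `L²` pairing of continuous functions. -/
def l2Pairing : C(X, ℂ) →L[ℝ] C(X, ℂ) →L[ℝ] ℝ :=
  LinearMap.mkContinuous₂
    (LinearMap.mk₂ ℝ (fun φ ψ : C(X, ℂ) => ∫ x, ⟪φ x, ψ x⟫ ∂ν)
      (fun φ φ' ψ => by
        simp only [ContinuousMap.add_apply, inner_add_left]
        exact integral_add (integrable_of_continuous_compact ν (by fun_prop))
          (integrable_of_continuous_compact ν (by fun_prop)))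
      (fun c φ ψ => by
        simp only [ContinuousMap.smul_apply, real_inner_smul_left, integral_const_mul, smul_eq_mul])
      (fun φ ψ ψ' => by
        simp only [ContinuousMap.add_apply, inner_add_right]
        exact integral_add (integrable_of_continuous_compact ν (by fun_prop))
          (integrable_of_continuous_compact ν (by fun_prop)))
      (fun c φ ψ => by
        simp only [ContinuousMap.smul_apply, real_inner_smul_right, integral_const_mul,
          smul_eq_mul]))
    (ν.real Set.univ) fun φ ψ => by
      rw [LinearMap.mk₂_apply]
      refine (norm_integral_le_of_norm_le_const (C := ‖φ‖ * ‖ψ‖) (ae_of_all _ fun x => ?_)).trans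
        (le_of_eq (by ring))
      exact (norm_inner_le_norm _ _).trans
        (mul_le_mul (φ.norm_coe_le_norm x) (ψ.norm_coe_le_norm x) (norm_nonneg _) (norm_nonneg _))

variable {H : Type*} [NormedAddCommGroup H] [InnerProductSpace ℝ H] [CompleteSpace H]
  {p : ℝ} (hp : 2 < p) (T : H →L[ℝ] C(X, ℂ))

/-- The gradient of `u ↦ (1 / p) ∫ |T u|^p`. -/
def potGrad (u : H) : H :=
  (InnerProductSpace.toDual ℝ H).symm ((l2Pairing ν (nemytskii hp T u)).comp T)

theorem inner_potGrad (u v : H) :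
    ⟪potGrad ν hp T u, v⟫ = ∫ x, ⟪powGrad p (T u x), T v x⟫ ∂ν := by
  rw [potGrad, InnerProductSpace.toDual_symm_apply]
  rfl

theorem continuous_dual_symm_comp : Continuous fun φ : C(X, ℂ) =>
    (InnerProductSpace.toDual ℝ H).symm ((l2Pairing ν φ).comp T) :=
  (InnerProductSpace.toDual ℝ H).symm.continuous.comp
    ((l2Pairing ν).continuous.clm_comp continuous_const)

theorem integrable_norm_rpow (hp : 2 < p) (φ : C(X, ℂ)) : Integrable (fun x => ‖φ x‖ ^ p) ν :=
  integrable_of_continuous_compact ν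
    (φ.continuous.norm.rpow_const fun _ => Or.inr (by linarith))

/-- The mass problem with nonlinearity `(1 / p) ∫ |T u|^p` for a compact operator `T`. -/
def MassProblem.ofCompact (S : H →L[ℝ] H) (symm : ∀ u v, ⟪S u, v⟫ = ⟪u, S v⟫)
    (pos : ∀ u, u ≠ 0 → 0 < ⟪S u, u⟫) (le_sq : ∀ u, ⟪S u, u⟫ ≤ ‖u‖ ^ 2)
    (hT : ∀ R : ℝ, ∃ K, IsCompact K ∧ ∀ u, ‖u‖ ≤ R → T u ∈ K) : MassProblem H p where
  S := S
  symm := symm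
  pos := pos
  le_sq := le_sq
  Ψ u := 1 / p * ∫ x, ‖T u x‖ ^ p ∂ν
  g := potGrad ν hp T
  nonneg u := mul_nonneg (by have := hp; positivity) (integral_nonneg fun x => by positivity)
  cont := (continuous_dual_symm_comp ν T).comp (continuous_nemytskii hp T)
  compact R := by
    obtain ⟨K, hK, h⟩ := hT R
    have hc : Continuous fun φ : C(X, ℂ) => (InnerProductSpace.toDual ℝ H).symm
        ((l2Pairing ν (ContinuousMap.comp ⟨powGrad p, continuous_powGrad hp⟩ φ)).comp T) :=
      (continuous_dual_symm_comp ν T).comp (ContinuousMap.continuous_postcomp _)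
    exact ⟨_, hK.image hc, fun u hu => ⟨T u, h u hu, rfl⟩⟩
  sub u v := by
    rw [inner_sub_right, inner_potGrad, inner_potGrad, ← integral_const_mul, ← integral_const_mul]
    simp_rw [inner_powGrad_self hp]
    have hc := continuous_powGrad hp
    have h1 : Integrable (fun x => ⟪powGrad p (T u x), T v x⟫) ν :=
      integrable_of_continuous_compact ν (by fun_prop)
    have h2 := integrable_norm_rpow ν hp (T u)
    have h3 := integrable_norm_rpow ν hp (T v)
    have h4 : Integrable (fun x => ⟪powGrad p (T u x), T v x⟫ - ‖T u x‖ ^ p) ν := h1.sub h2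
    rw [← integral_sub h1 h2, ← integral_add (h2.const_mul _) h4]
    exact integral_mono ((h2.const_mul _).add h4) (h3.const_mul _) fun x =>
      powGrad_subgradient hp _ _
  zero := by
    have : nemytskii hp T 0 = 0 := by
      ext x
      simp [nemytskii_apply, powGrad]
    simp [potGrad, this]
  euler u := by
    rw [inner_potGrad]
    simp_rw [inner_powGrad_self hp]
    rw [← mul_assoc, mul_one_div_cancel (by linarith), one_mul]
  hom t u ht := by
    have : ∀ x, ‖T (t • u) x‖ ^ p = t ^ p * ‖T u x‖ ^ p := fun x => by
      rw [map_smul, ContinuousMap.smul_apply, norm_smul, Real.norm_of_nonneg ht,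
        Real.mul_rpow ht (norm_nonneg _)]
    simp_rw [this]
    rw [integral_const_mul]
    ring
  bound := by
    refine ⟨1 / p * (ν.real Set.univ * ‖T‖ ^ p), by positivity, fun u => ?_⟩
    rw [mul_assoc]
    have h0 : 0 ≤ 1 / p := by positivity
    refine mul_le_mul_of_nonneg_left ?_ h0
    have h1 : ∀ x, ‖T u x‖ ^ p ≤ (‖T‖ * ‖u‖) ^ p := fun x =>
      Real.rpow_le_rpow (norm_nonneg _) (((T u).norm_coe_le_norm x).trans (T.le_opNorm u))
        (by linarith)
    refine (integral_mono (integrable_norm_rpow ν hp (T u)) (integrable_const _) h1).trans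
      (le_of_eq ?_)
    rw [integral_const, smul_eq_mul, Real.mul_rpow (norm_nonneg _) (norm_nonneg _), mul_assoc]

end Potential

/-! ### Compact restriction to the core -/

namespace MetricGraph

variable {Vert Bdd Half : Type*} (G : MetricGraph Vert Bdd Half) {A V : G.Pt → ℝ}

/-- The points of the compact core. -/
def coreSet : Set G.Pt := ⋃ b, (fun x : ℝ => (⟨Sum.inl b, x⟩ : G.Pt)) '' Set.Icc 0 (G.len b)

theorem mem_coreSet {b : Bdd} {x : ℝ} :
    (⟨Sum.inl b, x⟩ : G.Pt) ∈ G.coreSet ↔ x ∈ Set.Icc 0 (G.len b) := by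
  simp [coreSet]

theorem exists_of_mem_coreSet {q : G.Pt} (hq : q ∈ G.coreSet) :
    ∃ b x, x ∈ Set.Icc 0 (G.len b) ∧ q = ⟨Sum.inl b, x⟩ := by
  obtain ⟨b, x, hx, rfl⟩ := Set.mem_iUnion.1 hq
  exact ⟨b, x, hx, rfl⟩

theorem mem_coreSet_iff {q : G.Pt} : q ∈ G.coreSet ↔ q ∈ G.core ∧ q.2 ∈ G.interval q.1 := by
  refine ⟨fun h => ?_, ?_⟩
  · obtain ⟨b, x, hx, rfl⟩ := G.exists_of_mem_coreSet h
    exact ⟨⟨b, rfl⟩, hx⟩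
  · obtain ⟨e, x⟩ := q
    rintro ⟨⟨b, hb⟩, hx⟩
    simp only at hb
    subst hb
    exact G.mem_coreSet.2 hx

/-- The topology is that of the disjoint union of the edges, with ends meeting at a vertex left
unglued. This suffices, since only the supremum norm and integrals over the core are used. -/
theorem isCompact_coreSet [Finite Bdd] : IsCompact G.coreSet :=
  isCompact_iUnion fun _ => isCompact_Icc.image
    (continuous_sigmaMk (σ := fun _ : Bdd ⊕ Half => ℝ))

instance [Finite Bdd] : CompactSpace G.coreSet := isCompact_iff_compactSpace.1 G.isCompact_coreSet

instance : OpensMeasurableSpace G.Pt :=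
  ⟨MeasurableSpace.generateFrom_le fun _ hs =>
    G.measurableSet_pt.2 fun _ => (hs.preimage continuous_sigmaMk).measurableSet⟩

theorem measurableSet_coreSet [Finite Bdd] : MeasurableSet G.coreSet :=
  .iUnion fun b => by
    refine G.measurableSet_pt.2 fun e => ?_
    by_cases h : e = Sum.inl b
    · subst h
      convert (measurableSet_Icc : MeasurableSet (Set.Icc 0 (G.len b))) using 1
      ext x
      simp
    · convert MeasurableSet.empty using 1
      ext x
      simp [Ne.symm h]

theorem nhdsWithin_coreSet (b : Bdd) (x : ℝ) :
    𝓝[G.coreSet] (⟨Sum.inl b, x⟩ : G.Pt) =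
      map (fun y => ⟨Sum.inl b, y⟩) (𝓝[Set.Icc 0 (G.len b)] x) := by
  have h : (fun y : ℝ => (⟨Sum.inl b, y⟩ : G.Pt)) ⁻¹' G.coreSet = Set.Icc 0 (G.len b) := by
    ext y
    exact G.mem_coreSet
  rw [nhdsWithin, nhdsWithin, Sigma.nhds_mk, ← h, Filter.map_inf_principal_preimage]

/-- The set `core` also contains pairs whose coordinate lies outside the edge; they are negligible.
-/
theorem vol_restrict_core [Finite Bdd] [Finite Half] :
    G.vol.restrict G.core = G.vol.restrict G.coreSet := by
  refine Measure.restrict_congr_set ?_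
  filter_upwards [G.ae_mem_interval] with q hq
  exact propext (Iff.symm (G.mem_coreSet_iff.trans (and_iff_left hq)))

theorem vol_coreSet_lt_top [Finite Bdd] [Finite Half] : G.vol G.coreSet < ⊤ := by
  have := Fintype.ofFinite (Bdd ⊕ Half)
  rw [vol, Measure.sum_apply _ G.measurableSet_coreSet, tsum_fintype]
  refine ENNReal.sum_lt_top.2 fun e _ => ?_
  rw [Measure.map_apply (G.measurable_mk e) G.measurableSet_coreSet]
  rcases e with b | h
  · refine (Measure.restrict_apply_le _ _).trans_lt ?_
    refine (measure_mono (t := Set.Icc 0 (G.len b)) fun x hx => G.mem_coreSet.1 hx).trans_lt ?_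
    exact measure_Icc_lt_top
  · have : (fun x : ℝ => (⟨Sum.inr h, x⟩ : G.Pt)) ⁻¹' G.coreSet = ∅ := by
      ext x
      simp [mem_coreSet_iff, core]
    rw [this]
    simp

/-- The measure `dx` on the compact core. -/
def coreVol : Measure G.coreSet := G.vol.comap Subtype.val

instance [Finite Bdd] [Finite Half] : IsFiniteMeasure G.coreVol :=
  ⟨by
    rw [coreVol, comap_subtype_coe_apply G.measurableSet_coreSet, Set.image_univ,
      Subtype.range_coe]
    exact G.vol_coreSet_lt_top⟩

variable {G}

theorem IsCont.continuousOn_coreSet {f : G.Pt → ℂ} (hf : G.IsCont f) :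
    ContinuousOn f G.coreSet := by
  intro q hq
  obtain ⟨b, x, hx, rfl⟩ := G.exists_of_mem_coreSet hq
  rw [ContinuousWithinAt, nhdsWithin_coreSet, tendsto_map'_iff]
  exact hf.1 (Sum.inl b) x hx

/-- The continuous representative of an element of `H¹_A`. -/
def rep (u : G.H1A A V) : G.Pt → ℂ := (exists_isRep u).choose

theorem isRep_rep (u : G.H1A A V) : IsRep A (u : G.Pairs V) (rep u) := (exists_isRep u).choose_spec

theorem fn_ae_eq_rep (hV1 : ∀ᵐ q ∂G.vol, 1 ≤ V q) (u : G.H1A A V) : fn u =ᵐ[G.vol] rep u :=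
  (isRep_rep u).ae_eq_vol hV1

section Core

variable [Finite Bdd]

/-- Restriction to the compact core, as a linear map. -/
def coreLinear (hA : ∀ R : ℝ, MemLp A 2 (G.vol.restrict {q | q.2 ≤ R}))
    (hV1 : ∀ᵐ q ∂G.vol, 1 ≤ V q) :
    G.H1A A V →ₗ[ℝ] C(G.coreSet, ℂ) where
  toFun u := ⟨fun q => rep u q.1, (isRep_rep u).1.continuousOn_coreSet.domRestrict⟩
  map_add' u v := by
    ext ⟨q, hq⟩
    exact (isRep_rep (u + v)).eq_of_mem hA hV1 ((isRep_rep u).add (isRep_rep v))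
      (G.mem_coreSet_iff.1 hq).2
  map_smul' c u := by
    ext ⟨q, hq⟩
    exact (isRep_rep (c • u)).eq_of_mem hA hV1 ((isRep_rep u).smul (c : ℂ))
      (G.mem_coreSet_iff.1 hq).2

theorem exists_core_bound (hA : ∀ R : ℝ, MemLp A 2 (G.vol.restrict {q | q.2 ≤ R}))
    (hV1 : ∀ᵐ q ∂G.vol, 1 ≤ V q) :
    ∃ C, 0 ≤ C ∧ ∀ (u : G.H1A A V) b, ∀ x ∈ Set.Icc 0 (G.len b),
    ‖rep u ⟨Sum.inl b, x⟩‖ ≤ C * ‖u‖ := by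
  choose C hC H using fun b : Bdd =>
    IsRep.exists_norm_le hA hV1 (Sum.inl b) (G.len_pos b) (le_refl (Set.Icc 0 (G.len b)))
  obtain ⟨M, hM⟩ := Finite.bddAbove_range C
  refine ⟨max M 0, le_max_right _ _, fun u b x hx => (H b _ _ (isRep_rep u) x hx).trans ?_⟩
  have : C b ≤ max M 0 := (hM ⟨b, rfl⟩).trans (le_max_left _ _)
  exact mul_le_mul_of_nonneg_right this (norm_nonneg _)

theorem exists_coreLinear_bound (hA : ∀ R : ℝ, MemLp A 2 (G.vol.restrict {q | q.2 ≤ R}))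
    (hV1 : ∀ᵐ q ∂G.vol, 1 ≤ V q) :
    ∃ C, ∀ u : G.H1A A V, ‖coreLinear hA hV1 u‖ ≤ C * ‖u‖ := by
  obtain ⟨C, hC, H⟩ := exists_core_bound hA hV1
  refine ⟨C, fun u => (ContinuousMap.norm_le _ (by positivity)).2 ?_⟩
  rintro ⟨q, hq⟩
  obtain ⟨b, x, hx, rfl⟩ := G.exists_of_mem_coreSet hq
  exact H u b x hx

/-- Restriction to the compact core. -/
def coreMap (hA : ∀ R : ℝ, MemLp A 2 (G.vol.restrict {q | q.2 ≤ R}))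
    (hV1 : ∀ᵐ q ∂G.vol, 1 ≤ V q) :
    G.H1A A V →L[ℝ] C(G.coreSet, ℂ) :=
  LinearMap.mkContinuousOfExistsBound (coreLinear hA hV1) (exists_coreLinear_bound hA hV1)

/-- On a bounded set, the increment over `[y, z]` is at most a constant times `√(z - y)` plus a
constant times `∫ |A|` over `[y, z]`, and the latter is uniformly small with `z - y`. -/
theorem equicontinuous_rep (hA : ∀ R : ℝ, MemLp A 2 (G.vol.restrict {q | q.2 ≤ R}))
    (hV1 : ∀ᵐ q ∂G.vol, 1 ≤ V q) (M : ℝ) :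
    Equicontinuous fun (u : {u : G.H1A A V // ‖u‖ ≤ M}) (q : G.coreSet) => rep u.1 q.1 := by
  rintro ⟨q, hq⟩
  rw [Metric.equicontinuousAt_iff_right]
  intro ε hε
  rw [eventually_nhds_subtype_iff G.coreSet ⟨q, hq⟩
    (fun y => ∀ u : {u : G.H1A A V // ‖u‖ ≤ M}, dist (rep u.1 q) (rep u.1 y) < ε)]
  obtain ⟨b, x, hx, rfl⟩ := G.exists_of_mem_coreSet hq
  rw [nhdsWithin_coreSet, eventually_map]
  obtain ⟨C, hC, H⟩ := exists_core_bound hA hV1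
  have hR : Set.Icc 0 (G.len b) ⊆ G.interval (Sum.inl b) := le_rfl
  have hAb := G.memLp_edge_of_locally hA (Sum.inl b) hR
  set N := C * |M| + 1 with hN
  have hNpos : 0 < N := by positivity
  obtain ⟨δ, hδ, hint⟩ := exists_delta_integral_abs_lt (G.len_pos b).le hAb
    (show 0 < ε / (2 * N) by positivity)
  -- Each of the two contributions is thus kept below or at `ε / 2`; the square compensates the
  -- square root of the length.
  set δ' := min δ ((ε / (2 * (|M| + 1))) ^ 2)
  have hδ' : 0 < δ' := by positivity
  have key : ∀ (u : {u : G.H1A A V // ‖u‖ ≤ M}) (y z : ℝ), y ∈ Set.Icc 0 (G.len b) →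
      z ∈ Set.Icc 0 (G.len b) → y ≤ z → z - y < δ' →
      ‖rep u.1 ⟨Sum.inl b, z⟩ - rep u.1 ⟨Sum.inl b, y⟩‖ < ε := by
    intro u y z hy hz hyz hlt
    have hu : ‖u.1‖ ≤ |M| := u.2.trans (le_abs_self M)
    have h1 := ((isRep_rep u.1).isMagPrimitive (Sum.inl b) hR).norm_sub_le hAb hy hz hyz
      (M := N) fun t ht => (H u.1 b t ⟨hy.1.trans ht.1, ht.2.trans hz.2⟩).trans (by
        have := mul_le_mul_of_nonneg_left hu hC
        linarith)
    have h2 := hint y hy z hz hyz (hlt.trans_le (min_le_left _ _))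
    have h3 := l2norm_snd_le (u.1 : G.Pairs V) (Sum.inl b) hR
    have h4 : Real.sqrt (z - y) ≤ ε / (2 * (|M| + 1)) :=
      Real.sqrt_le_iff.2 ⟨by positivity, (hlt.trans_le (min_le_right _ _)).le⟩
    refine h1.trans_lt ?_
    have h5 : Real.sqrt (z - y) * l2norm (fun x => (u.1 : G.Pairs V).snd ⟨Sum.inl b, x⟩)
        (Set.Icc 0 (G.len b)) ≤ ε / (2 * (|M| + 1)) * (|M| + 1) := by
      have h6 : ‖(u.1 : G.Pairs V)‖ ≤ |M| + 1 := by
        have : ‖(u.1 : G.Pairs V)‖ = ‖u.1‖ := rfl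
        linarith
      exact mul_le_mul h4 (h3.trans h6) (l2norm_nonneg _ _) (by positivity)
    have h6 : ε / (2 * (|M| + 1)) * (|M| + 1) = ε / 2 := by field_simp
    have h7 : N * (∫ t in y..z, |A ⟨Sum.inl b, t⟩|) < ε / 2 := by
      calc _ < N * (ε / (2 * N)) := mul_lt_mul_of_pos_left h2 hNpos
        _ = ε / 2 := by field_simp
    linarith
  filter_upwards [self_mem_nhdsWithin, nhdsWithin_le_nhds (Metric.ball_mem_nhds x hδ')]
    with y hy hyx u
  rw [Metric.mem_ball, Real.dist_eq, abs_lt] at hyx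
  rw [dist_eq_norm]
  rcases le_total y x with hle | hle
  · exact key u y x hy hx hle (by linarith)
  · rw [norm_sub_rev]
    exact key u x y hx hy hle (by linarith)

/-- Arzelà–Ascoli, through the identification of continuous functions on a compact space with
bounded ones. -/
theorem exists_isCompact_coreMap (hA : ∀ R : ℝ, MemLp A 2 (G.vol.restrict {q | q.2 ≤ R}))
    (hV1 : ∀ᵐ q ∂G.vol, 1 ≤ V q) (M : ℝ) : ∃ K : Set C(G.coreSet, ℂ), IsCompact K ∧
    ∀ u : G.H1A A V, ‖u‖ ≤ M → coreMap hA hV1 u ∈ K := by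
  obtain ⟨C, hC, H⟩ := exists_core_bound hA hV1
  set S : Set (BoundedContinuousFunction G.coreSet ℂ) :=
    Set.range fun u : {u : G.H1A A V // ‖u‖ ≤ M} =>
      BoundedContinuousFunction.mkOfCompact (coreMap hA hV1 u.1)
  have hS : IsCompact (closure S) := by
    refine BoundedContinuousFunction.arzela_ascoli (Metric.closedBall 0 (C * |M|))
      (isCompact_closedBall _ _) S ?_ ?_
    · rintro _ ⟨q, hq⟩ ⟨u, rfl⟩
      obtain ⟨b, x, hx, rfl⟩ := G.exists_of_mem_coreSet hq
      rw [mem_closedBall_zero_iff]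
      refine (H u.1 b x hx).trans ?_
      have := u.2.trans (le_abs_self M)
      gcongr
    · intro q U hU
      filter_upwards [equicontinuous_rep hA hV1 M q U hU] with y hy
      rintro ⟨_, ⟨u, rfl⟩⟩
      exact hy u
  refine ⟨_, hS.image (ContinuousMap.isometryEquivBoundedOfCompact G.coreSet ℂ).symm.continuous,
    fun u hu => ?_⟩
  exact ⟨_, subset_closure ⟨⟨u, hu⟩, rfl⟩, rfl⟩

end Core

end MetricGraph

/-! ### `H¹_A` as an instance of the abstract problem -/

namespace MetricGraph

variable {Vert Bdd Half : Type*} {G : MetricGraph Vert Bdd Half} {A V : G.Pt → ℝ}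

theorem memLp_fn (hV1 : ∀ᵐ q ∂G.vol, 1 ≤ V q) (u : G.H1A A V) : MemLp (fn u) 2 G.vol :=
  memLp_fst hV1 (u : G.Pairs V)

/-- The real inner product on `H¹_A`. -/
instance : InnerProductSpace ℝ (G.H1A A V) where
  inner u v := RCLike.re (inner ℂ u v)
  norm_sq_eq_re_inner u := norm_sq_eq_re_inner (𝕜 := ℂ) u
  conj_inner_symm u v := (conj_trivial _).trans (inner_re_symm (𝕜 := ℂ) v u)
  add_left u v w := by rw [inner_add_left, map_add]
  smul_left u v c := by
    have h : c • u = (c : ℂ) • u := (algebraMap_smul ℂ c u).symm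
    have h1 : inner ℂ ((c : ℂ) • u) v = (c : ℂ) * inner ℂ u v :=
      (inner_smul_left u v (c : ℂ)).trans (by rw [Complex.conj_ofReal])
    rw [h, h1, conj_trivial]
    exact RCLike.re_ofReal_mul c _

theorem real_inner_eq_re (u v : G.H1A A V) : ⟪u, v⟫ = (inner ℂ u v).re := rfl

/-- The embedding of `H¹_A` into `L²`. -/
def toL2 (A : G.Pt → ℝ) (hV1 : ∀ᵐ q ∂G.vol, 1 ≤ V q) : G.H1A A V →L[ℂ] G.L2 :=
  LinearMap.mkContinuous
    { toFun := fun u => (memLp_fn hV1 u).toLp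
      map_add' := fun u v => by
        rw [← MemLp.toLp_add]
        exact MemLp.toLp_congr _ _ (ae_vol_of_ae_volV hV1 (Lp.coeFn_add _ _))
      map_smul' := fun c u => by
        rw [RingHom.id_apply, ← MemLp.toLp_const_smul]
        exact MemLp.toLp_congr _ _ (ae_vol_of_ae_volV hV1 (Lp.coeFn_smul _ _)) }
    1 fun u => by
      rw [one_mul, LinearMap.coe_mk, AddHom.coe_mk, Lp.norm_toLp]
      exact eLpNorm_fst_le hV1 (u : G.Pairs V)

theorem toL2_ae_eq (hV1 : ∀ᵐ q ∂G.vol, 1 ≤ V q) (u : G.H1A A V) : toL2 A hV1 u =ᵐ[G.vol] fn u :=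
  MemLp.coeFn_toLp (memLp_fn hV1 u)

theorem norm_toL2_le (hV1 : ∀ᵐ q ∂G.vol, 1 ≤ V q) (u : G.H1A A V) : ‖toL2 A hV1 u‖ ≤ ‖u‖ := by
  change ‖(memLp_fn hV1 u).toLp‖ ≤ _
  rw [Lp.norm_toLp]
  exact eLpNorm_fst_le hV1 (u : G.Pairs V)

theorem inner_toL2_right (hV1 : ∀ᵐ q ∂G.vol, 1 ≤ V q) (y : G.L2) (v : G.H1A A V) :
    inner ℂ (toL2 A hV1 v) y = ∫ q, y q * starRingEnd ℂ (fn v q) ∂G.vol := by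
  rw [L2.inner_def]
  refine integral_congr_ae ?_
  filter_upwards [toL2_ae_eq hV1 v] with q hq
  rw [hq, RCLike.inner_apply]

theorem inner_toL2 (hV1 : ∀ᵐ q ∂G.vol, 1 ≤ V q) (u v : G.H1A A V) :
    inner ℂ (toL2 A hV1 v) (toL2 A hV1 u) = ∫ q, fn u q * starRingEnd ℂ (fn v q) ∂G.vol := by
  rw [inner_toL2_right]
  refine integral_congr_ae ?_
  filter_upwards [toL2_ae_eq hV1 u] with q hq
  rw [hq]

theorem mass_eq (hV1 : ∀ᵐ q ∂G.vol, 1 ≤ V q) (u : G.H1A A V) : mass u = ‖toL2 A hV1 u‖ ^ 2 := by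
  have h := inner_toL2 hV1 u u
  have h2 : ∀ q, fn u q * starRingEnd ℂ (fn u q) = ((‖fn u q‖ ^ 2 : ℝ) : ℂ) := fun q => by
    rw [Complex.mul_conj, Complex.normSq_eq_norm_sq]
  simp_rw [h2] at h
  rw [integral_complex_ofReal, inner_self_eq_norm_sq_to_K] at h
  refine Complex.ofReal_injective ?_
  rw [Complex.ofReal_pow]
  exact h.symm

/-- Elements of `H¹_A` are pairs, so the derivative must be recovered too: a function vanishing
almost everywhere has zero continuous representative, hence zero magnetic derivative on each compact
interval. Half-lines are exhausted by such intervals. -/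
theorem toL2_ne_zero [Finite Bdd] [Finite Half] (hV1 : ∀ᵐ q ∂G.vol, 1 ≤ V q)
    {u : G.H1A A V} (hu : u ≠ 0) : toL2 A hV1 u ≠ 0 := by
  intro h0
  apply hu
  have hfn : fn u =ᵐ[G.vol] 0 := by
    have h1 := toL2_ae_eq hV1 u
    rw [h0] at h1
    exact h1.symm.trans (Lp.coeFn_zero _ _ _)
  have hrep : rep u =ᵐ[G.vol] 0 := (fn_ae_eq_rep hV1 u).symm.trans hfn
  have hsnd : ∀ e R, 0 < R → Set.Icc 0 R ⊆ G.interval e →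
      ∀ᵐ x ∂(volume.restrict (Set.Icc 0 R)), (u : G.Pairs V).snd ⟨e, x⟩ = 0 := by
    intro e R hR0 hR
    have hp := (isRep_rep u).isMagPrimitive e hR
    refine hp.ae_eq_zero hR0.le ?_
    refine Measure.eqOn_Icc_of_ae_eq (g := fun _ => (0 : ℂ)) volume hR0.ne ?_ hp.cont
      continuousOn_const
    exact ae_restrict_of_ae_restrict_of_subset hR (G.ae_edge hrep e)
  have hs : (u : G.Pairs V).snd = 0 := by
    refine Lp.ext (EventuallyEq.trans ?_ (Lp.coeFn_zero _ _ _).symm)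
    refine G.ae_vol_iff.2 fun e => ?_
    rcases e with b | k
    · exact hsnd (Sum.inl b) (G.len b) (G.len_pos b) le_rfl
    · have h1 : ∀ n : ℕ, ∀ᵐ x, x ∈ Set.Icc (0 : ℝ) (n + 1) →
          (u : G.Pairs V).snd ⟨Sum.inr k, x⟩ = 0 := fun n =>
        (ae_restrict_iff' measurableSet_Icc).1
          (hsnd (Sum.inr k) (n + 1) (by positivity) fun x hx => hx.1)
      rw [ae_restrict_iff' (G.measurableSet_interval _)]
      filter_upwards [ae_all_iff.2 h1] with x hx hx0
      obtain ⟨n, hn⟩ := exists_nat_ge x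
      exact hx n ⟨hx0, by linarith⟩
  have hf : (u : G.Pairs V).fst = 0 :=
    Lp.ext (EventuallyEq.trans (ae_volV_of_ae_vol hfn) (Lp.coeFn_zero _ _ _).symm)
  ext1
  exact (WithLp.ofLp_injective 2) (Prod.ext hf hs)

theorem mass_nonneg (u : G.H1A A V) : 0 ≤ mass u := integral_nonneg fun _ => by positivity

theorem mass_pos [Finite Bdd] [Finite Half] (hV1 : ∀ᵐ q ∂G.vol, 1 ≤ V q)
    {u : G.H1A A V} (hu : u ≠ 0) : 0 < mass u := by
  rw [mass_eq hV1]
  have := norm_pos_iff.2 (toL2_ne_zero hV1 hu)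
  positivity

theorem lambda1_mul_mass_le (hV1 : ∀ᵐ q ∂G.vol, 1 ≤ V q) (u : G.H1A A V) :
    G.lambda1 A V * mass u ≤ ‖u‖ ^ 2 := by
  rcases eq_or_ne u 0 with rfl | hu
  · rw [mass_eq hV1, map_zero]
    simp
  have hb : BddBelow (Set.range fun u : {u : G.H1A A V // u ≠ 0} => ‖u.1‖ ^ 2 / mass u.1) :=
    ⟨0, by rintro _ ⟨v, rfl⟩; exact div_nonneg (by positivity) (mass_nonneg _)⟩
  have h1 : G.lambda1 A V ≤ ‖u‖ ^ 2 / mass u := ciInf_le hb ⟨u, hu⟩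
  rcases (mass_nonneg u).eq_or_lt with h0 | h0
  · rw [← h0, mul_zero]; positivity
  · rwa [le_div_iff₀ h0] at h1

theorem Psi_eq [Finite Bdd] [Finite Half]
    (hA : ∀ R : ℝ, MemLp A 2 (G.vol.restrict {q | q.2 ≤ R}))
    (hV1 : ∀ᵐ q ∂G.vol, 1 ≤ V q) (p : ℝ) (u : G.H1A A V) :
    Psi p u = 1 / p * ∫ q, ‖coreMap hA hV1 u q‖ ^ p ∂G.coreVol := by
  rw [Psi, G.vol_restrict_core]
  congr 1
  have h := integral_subtype_comap (μ := G.vol) G.measurableSet_coreSet fun q => ‖rep u q‖ ^ p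
  refine Eq.trans ?_ h.symm
  refine integral_congr_ae (ae_restrict_of_ae ?_)
  filter_upwards [fn_ae_eq_rep hV1 u] with q hq
  rw [hq]

/-- The constrained problem for the energy on `H¹_A`. -/
def massProblem [Finite Bdd] [Finite Half] [CompleteSpace (G.H1A A V)]
    (hA : ∀ R : ℝ, MemLp A 2 (G.vol.restrict {q | q.2 ≤ R}))
    (hV1 : ∀ᵐ q ∂G.vol, 1 ≤ V q) {p : ℝ} (hp : 2 < p) : MassProblem (G.H1A A V) p :=
  -- The operator `S` is `J* J` for the embedding `J` into `L²`, so that it represents the real `L²`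
  -- pairing.
  have hS : ∀ u v : G.H1A A V,
      ⟪((toL2 A hV1).adjoint ∘L toL2 A hV1).restrictScalars ℝ u, v⟫ =
        (inner ℂ (toL2 A hV1 u) (toL2 A hV1 v)).re := fun u v => by
    rw [real_inner_eq_re]
    simp [ContinuousLinearMap.adjoint_inner_left]
  MassProblem.ofCompact G.coreVol hp (coreMap hA hV1)
    (((toL2 A hV1).adjoint ∘L toL2 A hV1).restrictScalars ℝ)
    (fun u v => by
      rw [hS, real_inner_comm, hS, ← inner_conj_symm, Complex.conj_re])
    (fun u hu => by
      rw [hS, ← RCLike.re_eq_complex_re, inner_self_eq_norm_sq]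
      have := norm_pos_iff.2 (toL2_ne_zero hV1 hu)
      positivity)
    (fun u => by
      rw [hS, ← RCLike.re_eq_complex_re, inner_self_eq_norm_sq]
      have := norm_toL2_le hV1 u
      gcongr)
    (exists_isCompact_coreMap hA hV1)

section MassProblem

variable [Finite Bdd] [Finite Half] [CompleteSpace (G.H1A A V)]
  {p : ℝ}

theorem inner_massProblem_S (hA : ∀ R : ℝ, MemLp A 2 (G.vol.restrict {q | q.2 ≤ R}))
    (hV1 : ∀ᵐ q ∂G.vol, 1 ≤ V q) (hp : 2 < p) (u v : G.H1A A V) : ⟪(massProblem hA hV1 hp).S u, v⟫ =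
    (∫ q, fn u q * starRingEnd ℂ (fn v q) ∂G.vol).re := by
  rw [← inner_toL2 hV1, ← inner_conj_symm (𝕜 := ℂ), Complex.conj_re]
  exact congrArg Complex.re (ContinuousLinearMap.adjoint_inner_left (toL2 A hV1) v (toL2 A hV1 u))

theorem massProblem_m (hA : ∀ R : ℝ, MemLp A 2 (G.vol.restrict {q | q.2 ≤ R}))
    (hV1 : ∀ᵐ q ∂G.vol, 1 ≤ V q) (hp : 2 < p) (u : G.H1A A V) : (massProblem hA hV1 hp).m u = mass u := by
  rw [MassProblem.m, inner_massProblem_S, ← inner_toL2 hV1, ← RCLike.re_eq_complex_re,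
    inner_self_eq_norm_sq, mass_eq hV1]

theorem massProblem_Psi (hA : ∀ R : ℝ, MemLp A 2 (G.vol.restrict {q | q.2 ≤ R}))
    (hV1 : ∀ᵐ q ∂G.vol, 1 ≤ V q) (hp : 2 < p) (u : G.H1A A V) : (massProblem hA hV1 hp).Ψ u = Psi p u :=
  (Psi_eq hA hV1 p u).symm

theorem hasFDerivAt_energy (hA : ∀ R : ℝ, MemLp A 2 (G.vol.restrict {q | q.2 ≤ R}))
    (hV1 : ∀ᵐ q ∂G.vol, 1 ≤ V q) (hp : 2 < p) (u : G.H1A A V) :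
    HasFDerivAt (energy p) (innerSL ℝ (u - (massProblem hA hV1 hp).g u)) u := by
  have h : energy p = fun u : G.H1A A V =>
      1 / 2 * ‖u‖ ^ 2 - (massProblem hA hV1 hp).Ψ u := by
    funext u
    rw [energy, massProblem_Psi]
  rw [h]
  exact (massProblem hA hV1 hp).hasFDerivAt_energy u

theorem isCritical_of_solution (hA : ∀ R : ℝ, MemLp A 2 (G.vol.restrict {q | q.2 ≤ R}))
    (hV1 : ∀ᵐ q ∂G.vol, 1 ≤ V q) (hp : 2 < p) {l : ℝ} {u : G.H1A A V}
    (h : u - l • (massProblem hA hV1 hp).S u - (massProblem hA hV1 hp).g u = 0) :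
    IsCritical p (mass u) l u := by
  refine ⟨rfl, _, hasFDerivAt_energy hA hV1 hp u, fun v => ?_⟩
  rw [← inner_massProblem_S hA hV1 hp]
  exact (massProblem hA hV1 hp).inner_sub_g_of_solution h v

end MassProblem

end MetricGraph

/-! ### Bottom of the spectrum -/

namespace MetricGraph

variable {Vert Bdd Half : Type*} {G : MetricGraph Vert Bdd Half} {A V : G.Pt → ℝ}

theorem eq_toL2_of_ae_eq (hV1 : ∀ᵐ q ∂G.vol, 1 ≤ V q) {x : G.L2} {u : G.H1A A V}
    (h : x =ᵐ[G.vol] fn u) : x = toL2 A hV1 u :=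
  Lp.ext (h.trans (toL2_ae_eq hV1 u).symm)

theorem exists_eigenfunction (hV1 : ∀ᵐ q ∂G.vol, 1 ≤ V q) {t : ℂ}
    (h : OpGraph.IsEigenvalue (G.opGraph A V) t) : ∃ u : G.H1A A V, u ≠ 0 ∧
      ∀ v, inner ℂ v u = t * inner ℂ (toL2 A hV1 v) (toL2 A hV1 u) := by
  obtain ⟨x, hx, u, hu, hv⟩ := h
  have hxu := eq_toL2_of_ae_eq hV1 hu
  refine ⟨u, ?_, fun v => ?_⟩
  · rintro rfl
    exact hx (hxu.trans (map_zero _))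
  · have hxu' : x = toL2 A hV1 u := hxu
    rw [hv v, ← inner_toL2_right hV1, ← hxu', inner_smul_right]

theorem norm_sq_eq_of_eigenfunction (hV1 : ∀ᵐ q ∂G.vol, 1 ≤ V q) {t : ℝ} {u : G.H1A A V}
    (h : ∀ v, inner ℂ v u = (t : ℂ) * inner ℂ (toL2 A hV1 v) (toL2 A hV1 u)) :
    ‖u‖ ^ 2 = t * mass u := by
  have h1 := h u
  rw [inner_self_eq_norm_sq_to_K] at h1
  rw [mass_eq hV1]
  refine Complex.ofReal_injective ?_
  rw [Complex.ofReal_mul, Complex.ofReal_pow, Complex.ofReal_pow]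
  exact (inner_self_eq_norm_sq_to_K (𝕜 := ℂ) u).symm.trans h1

/-- The infimum of the Rayleigh quotient belongs to the spectrum. -/
theorem lambda1_mem_spectrum [Finite Bdd] [Finite Half] (hV1 : ∀ᵐ q ∂G.vol, 1 ≤ V q)
    {φ : G.H1A A V} (hφ : φ ≠ 0) :
    ((G.lambda1 A V : ℝ) : ℂ) ∈ OpGraph.spectrum (G.opGraph A V) := by
  rintro ⟨hsurj, C, hC⟩
  set Λ := G.lambda1 A V with hΛ
  set N := max C 1
  have hN : 0 < N := lt_of_lt_of_le one_pos (le_max_right _ _)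
  -- If `Λ` were in the resolvent set, the Rayleigh quotient would have the larger lower bound `Λ +
  -- 1/N`.
  have hgap : ∀ u : G.H1A A V, (Λ + 1 / N) * mass u ≤ ‖u‖ ^ 2 := by
    intro u
    obtain ⟨y, ⟨w, hyw, hv⟩, hyg⟩ := hsurj (toL2 A hV1 u)
    have hy1 := eq_toL2_of_ae_eq hV1 hyw
    have hbound := hC y ⟨w, hyw, hv⟩
    rw [hyg, hy1] at hbound
    have hform : ∀ v : G.H1A A V, (inner ℂ v w).re -
        Λ * (inner ℂ (toL2 A hV1 v) (toL2 A hV1 w)).re =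
        (inner ℂ (toL2 A hV1 v) (toL2 A hV1 u)).re := by
      intro v
      have h2 : y.2 = toL2 A hV1 u + (Λ : ℂ) • toL2 A hV1 w := by
        rw [← hyg, hy1]; abel
      have h3 : inner ℂ v w = inner ℂ (toL2 A hV1 v) (toL2 A hV1 u) +
          (Λ : ℂ) * inner ℂ (toL2 A hV1 v) (toL2 A hV1 w) := by
        rw [hv v, ← inner_toL2_right hV1, h2, inner_add_right, inner_smul_right]
      rw [h3, Complex.add_re, Complex.re_ofReal_mul]
      ring
    have hu := hform u
    have hw := hform w
    rw [← RCLike.re_eq_complex_re, inner_self_eq_norm_sq (𝕜 := ℂ) (toL2 A hV1 u)] at hu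
    rw [← RCLike.re_eq_complex_re, inner_self_eq_norm_sq (𝕜 := ℂ) w,
      inner_self_eq_norm_sq (𝕜 := ℂ) (toL2 A hV1 w)] at hw
    have hcs : RCLike.re (inner ℂ (toL2 A hV1 w) (toL2 A hV1 u)) ≤ N * ‖toL2 A hV1 u‖ ^ 2 := by
      refine (re_inner_le_norm _ _).trans ?_
      have : ‖toL2 A hV1 w‖ ≤ N * ‖toL2 A hV1 u‖ := hbound.trans (by
        gcongr
        exact le_max_left _ _)
      nlinarith [norm_nonneg (toL2 A hV1 u)]
    have hsmul : inner ℂ u (((1 / N : ℝ) : ℂ) • w) = ((1 / N : ℝ) : ℂ) * inner ℂ u w :=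
      inner_smul_right u w ((1 / N : ℝ) : ℂ)
    -- Let `(T - Λ) w = u` in `L²`. The nonnegative form of `T - Λ` is tested on `u - w / N`: the
    -- cross term contributes `-2 ‖u‖₂² / N` and the square of `w / N` at most `‖u‖₂² / N`, by the
    -- resolvent bound `‖w‖₂ ≤ N ‖u‖₂`. Hence the form at `u` is at least `‖u‖₂² / N`.
    have hpos := lambda1_mul_mass_le hV1 (u - ((1 / N : ℝ) : ℂ) • w)
    rw [mass_eq hV1, map_sub, map_smul, norm_sub_sq (𝕜 := ℂ), norm_sub_sq (𝕜 := ℂ),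
      inner_smul_right, hsmul, norm_smul, norm_smul, Complex.norm_real,
      Real.norm_of_nonneg (by positivity), RCLike.re_eq_complex_re, Complex.re_ofReal_mul,
      Complex.re_ofReal_mul] at hpos
    rw [mass_eq hV1]
    rw [RCLike.re_eq_complex_re] at hu hw hcs
    set s := 1 / N with hs
    have hs0 : 0 < s := by positivity
    have hsN : s * N = 1 := by rw [hs]; field_simp
    have h4 : s ^ 2 * (‖w‖ ^ 2 - Λ * ‖toL2 A hV1 w‖ ^ 2) ≤ s * ‖toL2 A hV1 u‖ ^ 2 := by
      rw [hw]
      calc _ ≤ s ^ 2 * (N * ‖toL2 A hV1 u‖ ^ 2) := by gcongr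
        _ = s * (s * N) * ‖toL2 A hV1 u‖ ^ 2 := by ring
        _ = _ := by rw [hsN, mul_one]
    have h5 := congrArg (fun z => 2 * s * z) hu
    linarith
  have : Nonempty {u : G.H1A A V // u ≠ 0} := ⟨⟨φ, hφ⟩⟩
  have h1 : Λ + 1 / N ≤ Λ := by
    rw [hΛ]
    refine le_ciInf fun u => ?_
    rw [le_div_iff₀ (mass_pos hV1 u.2)]
    exact hgap u.1
  have : 0 < 1 / N := by positivity
  linarith

/-- Under condition (G_m), `λ₁` is an eigenvalue. -/
theorem CondGm.exists_eigenfunction_lambda1 [Finite Bdd] [Finite Half]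
    (hV1 : ∀ᵐ q ∂G.vol, 1 ≤ V q) {m : ℕ∞} (h : G.CondGm A V m) :
    ∃ u : G.H1A A V, u ≠ 0 ∧
      ∀ v, inner ℂ v u = (G.lambda1 A V : ℂ) * inner ℂ (toL2 A hV1 v) (toL2 A hV1 u) := by
  obtain ⟨hm, l, -, hl⟩ := h
  obtain ⟨h1, h2⟩ := hl 0 (by rw [Nat.cast_zero]; exact lt_of_lt_of_le one_pos hm)
  obtain ⟨φ, hφ, hφv⟩ := exists_eigenfunction hV1 h1
  have hle : G.lambda1 A V ≤ l 0 := by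
    have h3 := lambda1_mul_mass_le hV1 φ
    rw [norm_sq_eq_of_eigenfunction hV1 hφv] at h3
    exact le_of_mul_le_mul_right h3 (mass_pos hV1 hφ)
  -- Only the first eigenvalue in (G_m) matters: it bounds `λ₁` from above and lies strictly below
  -- the essential spectrum.
  have hess : ((G.lambda1 A V : ℝ) : ℂ) ∉ OpGraph.essSpectrum (G.opGraph A V) := by
    intro hmem
    have h3 : OpGraph.infEss (G.opGraph A V) ≤ (G.lambda1 A V : EReal) :=
      iInf₂_le (G.lambda1 A V) hmem
    exact absurd (h2.trans_le h3) (not_lt.2 (EReal.coe_le_coe_iff.2 hle))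
  have hdisc : ((G.lambda1 A V : ℝ) : ℂ) ∈ OpGraph.discreteSpectrum (G.opGraph A V) := by
    by_contra hn
    exact hess ⟨lambda1_mem_spectrum hV1 hφ, hn⟩
  exact exists_eigenfunction hV1 hdisc.2.2.1

theorem Psi_pos_of_not_ae_zero [Finite Bdd] [Finite Half]
    (hA : ∀ R : ℝ, MemLp A 2 (G.vol.restrict {q | q.2 ≤ R}))
    (hV1 : ∀ᵐ q ∂G.vol, 1 ≤ V q) {p : ℝ} (hp : 2 < p) {u : G.H1A A V}
    (hu : ¬ fn u =ᵐ[G.vol.restrict G.core] 0) : 0 < Psi p u := by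
  rw [Psi_eq hA hV1]
  refine mul_pos (by positivity) ?_
  have hnn : 0 ≤ fun q => ‖coreMap hA hV1 u q‖ ^ p := fun q => by positivity
  refine (integral_nonneg hnn).lt_of_ne' fun h0 => hu ?_
  rw [integral_eq_zero_iff_of_nonneg hnn (integrable_norm_rpow G.coreVol hp _)] at h0
  have h1 : ∀ᵐ q ∂G.coreVol, rep u q.1 = 0 := by
    filter_upwards [h0] with q hq
    have h2 : ‖coreMap hA hV1 u q‖ ^ p = 0 := hq
    exact norm_eq_zero.1 ((Real.rpow_eq_zero (norm_nonneg _) (by linarith)).1 h2)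
  rw [← (MeasurableEmbedding.subtype_coe G.measurableSet_coreSet).ae_map_iff
    (p := fun q => rep u q = 0), coreVol, map_comap_subtype_coe G.measurableSet_coreSet] at h1
  rw [G.vol_restrict_core]
  filter_upwards [h1, ae_restrict_of_ae (fn_ae_eq_rep hV1 u)] with q h2 h3
  rw [h3, h2]
  rfl

theorem Psi_eq_zero_of_ae_zero {p : ℝ} (hp : 2 < p) {u : G.H1A A V}
    (hu : fn u =ᵐ[G.vol.restrict G.core] 0) : Psi p u = 0 := by
  have : ∫ q in G.core, ‖fn u q‖ ^ p ∂G.vol = 0 := by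
    refine integral_eq_zero_of_ae ?_
    filter_upwards [hu] with q hq
    rw [hq]
    simp [Real.zero_rpow (by linarith : p ≠ 0)]
  rw [Psi, this, mul_zero]

end MetricGraph

end

/-! ### Conclusion -/

open MetricGraph in
theorem theorem1p2 {Vert Bdd Half : Type*} [Finite Bdd] [Finite Half] [Nonempty Bdd]
    (G : MetricGraph Vert Bdd Half) (A V : G.Pt → ℝ)
    (hA : ∀ R : ℝ, MemLp A 2 (G.vol.restrict {q | q.2 ≤ R}))
    (hV : ∀ R : ℝ, IntegrableOn V {q | q.2 ≤ R} G.vol)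
    (hV1 : ∀ᵐ q ∂G.vol, 1 ≤ V q)
    (p : ℝ) (hp : 2 < p)
    (hG : G.CondG A V ∨ ∃ m : ℕ∞, G.CondGm A V m)
    (μ : ℝ) (hμ : 0 < μ) :
    (∃ l : ℝ, l ≤ G.lambda1 A V ∧ (G.CondG A V → l < G.lambda1 A V) ∧
        ∃ u : G.H1A A V, IsCritical p μ l u) ∨
      ∀ l : ℝ, l < G.lambda1 A V →
        ∃ ν : ℝ, 0 < ν ∧ ν < μ ∧ ∃ u : G.H1A A V, IsCritical p ν l u := by
  have hcomplete : CompleteSpace (G.H1A A V) := (isClosed_H1A hA hV1).completeSpace_coe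
  set D := massProblem hA hV1 hp
  have hm : ∀ u, D.m u = mass u := massProblem_m hA hV1 hp
  have hΨ : ∀ u, D.Ψ u = Psi p u := massProblem_Psi hA hV1 hp
  by_cases hcond : G.CondG A V
  · obtain ⟨φ, hφ0, hφ, hφcore⟩ := hcond
    rw [div_eq_iff (mass_pos hV1 hφ0).ne', ← hm] at hφ
    have hφΨ : 0 < D.Ψ φ := by
      rw [hΨ]
      exact Psi_pos_of_not_ae_zero hA hV1 hp hφcore
    -- The solution depends on `l`. If for a single `l` it has mass `μ`, the first alternative
    -- holds; otherwise every `l` yields a smaller mass.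
    rw [or_iff_not_imp_left]
    intro hn l hl
    obtain ⟨w, t, hw, ⟨hwm, ht⟩ | ⟨h0, h1, rfl⟩⟩ := D.exists_solution hp
      (fun u => by rw [hm]; exact lambda1_mul_mass_le hV1 u) hφ hφΨ hμ hl
    · refine absurd ⟨t, ht.le, fun _ => ht, w, ?_⟩ hn
      rw [← hwm, hm]
      exact isCritical_of_solution hA hV1 hp hw
    · rw [hm] at h0 h1
      exact ⟨mass w, h0, h1, w, isCritical_of_solution hA hV1 hp hw⟩
  · left
    refine ⟨G.lambda1 A V, le_rfl, fun h => absurd h hcond, ?_⟩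
    obtain ⟨m, hGm⟩ := hG.resolve_left hcond
    obtain ⟨φ, hφ0, hφ⟩ := hGm.exists_eigenfunction_lambda1 hV1
    have hmass := mass_pos hV1 hφ0
    -- An eigenfunction at `λ₁` achieves the infimum, so failure of (G) forces it to vanish on the
    -- core.
    have hcore : fn φ =ᵐ[G.vol.restrict G.core] 0 := by
      by_contra hn
      refine hcond ⟨φ, hφ0, ?_, hn⟩
      rw [norm_sq_eq_of_eigenfunction hV1 hφ, mul_div_cancel_right₀ _ hmass.ne']
    have hφS : φ - G.lambda1 A V • D.S φ = 0 := D.sub_smul_eq_zero_of_inner fun v => by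
      rw [inner_massProblem_S, ← inner_toL2 hV1, real_inner_comm, real_inner_eq_re, hφ,
        Complex.re_ofReal_mul]
    -- Rescaling to mass `μ` is free, since the equation reduces to the linear one on multiples of
    -- `φ`.
    set c := Real.sqrt (μ / mass φ)
    have hc : 0 ≤ c := Real.sqrt_nonneg _
    have hsol : c • φ - G.lambda1 A V • D.S (c • φ) - D.g (c • φ) = 0 := by
      have hg : D.g (c • φ) = 0 := D.g_eq_zero_of_Ψ_eq_zero (by
        rw [D.hom c φ hc, hΨ, Psi_eq_zero_of_ae_zero hp hcore, mul_zero])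
      rw [hg, sub_zero, map_smul, smul_comm, ← smul_sub, hφS, smul_zero]
    have hmc : mass (c • φ) = μ := by
      rw [← hm, D.m_smul, hm, Real.sq_sqrt (by positivity), div_mul_cancel₀ _ hmass.ne']
    refine ⟨c • φ, ?_⟩
    have := isCritical_of_solution hA hV1 hp hsol
    rwa [hmc] at this
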